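/- **The calculus.** Types are built from primitive types $p_1,p_2,\dots$ with a binary connective $\backslash$ and a unary connective $!$. Sequents have the form $\Gamma\to A$, where $A$ is a type and $\Gamma$ is a finite, possibly empty, sequence of types. The calculus $L^*(\backslash,!)$ has the axioms $p_i\to p_i$ and the rules $$\frac{A\,\Pi\to B}{\Pi\to A\backslash B},\qquad \frac{\Pi\to A\quad \Gamma B\Delta\to C}{\Gamma\,\Pi\,(A\backslash B)\,\Delta\to C},\qquad \frac{\Gamma A\Delta\to B}{\Gamma\,{!A}\,\Delta\to B},\qquad \frac{\Gamma\Delta\to B}{\Gamma\,{!A}\,\Delta\to B}.$$ **The tree of a type.** To every type one associates a finite rooted tree with vertex set $V$, arcs $O$ directed towards the root, a labelling of its leaves by primitive types, a labelling $\mathrm{op}$ of its arcs by $-1,1,2$, and a strict linear order $<$ on $V$, as follows. - A primitive type gives one vertex, labelled by this primitive type. - For $!A$, add to the tree of $A$ a new root and an arc with label $2$ from the root of $A$ to the new root; the new root becomes the least element of the order, which is otherwise that of $A$. - For $A\backslash B$, take the disjoint union of the trees of $A$ and $B$ and add a new root, an arc with label $-1$ from the root of $A$ to it, and an arc with label $1$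 from the root of $B$ to it; the order is the reversed order of $A$, then the new root, then the order of $B$. The tree of a sequent $A_1\dots A_n\to B$ is the tree of the type $A_n\backslash(A_{n-1}\backslash\dots\backslash(A_1\backslash B)\dots)$. Let $W$ be the set of leaves, $d(a)$ the number of arcs with label $-1$ on the path from $a$ to the root, $H(a)$ the unique leaf from which a path without arcs labelled $-1$ leads to $a$, and $O^*$ the reflexive transitive closure of $O$. **Proof nets.** A proof net for a sequent consists of its tree, with the labellings and the order, a set $U\subseteq V$ and a relation $S\subseteq W\times W$ such that: - PN1. $S$ is symmetric. - PN2. $S$ is functional: if $(a,b),(a,c)\in S$, then $b=c$; one writes $b=S(a)$. - PN3. If $(a,b),(c,d)\in S$ and $a<c<b$, then $a<d<b$. - PN4. If $(a,b)\in S$, then $a$ and $b$ have the same label. - PN5. $(a,a)\notin S$ for all $a$; and if $(a,b)\in S$ and $a<b$, then $d(a)=d(b)+1$. - PN6. If $a\,O^*\,c$, $H(c)=b$, $S(a)$ and $S(b)$ are defined and $a<S(b)<b$, then there is a vertex $e$ with $S(a)\,O^*\,e$ and $H(e)=b$. - PN7. $S\neq\varnothing$. - PN8. $\{a\mid \exists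 b\;(a,b)\in S\}=W\cap U$. - PN9. If $a\,O\,b$ and $b\notin U$, then $a\notin U$. - PN10. If $a\,O\,b$, $a\notin U$ and $\mathrm{op}(a,b)\ne 2$, then $b\notin U$. - PN11. If $a\,O\,b$ and $d(b)$ is even, then $\mathrm{op}(a,b)\neq 2$. **Theorem.** If there is a proof net for a sequent $\Phi\to D$, then $\Phi\to D$ is derivable in $L^*(\backslash,!)$. -/

import Mathlib

namespace LambekBang

/-- Types built from the primitive types `p_i` with left division `A \ B` and the modality `!A`. -/
inductive Tp : Type
  | prim (i : ℕ) : Tp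
  | bang (A : Tp) : Tp
  | ldiv (A B : Tp) : Tp

/-- `Derivable Γ A`: the sequent `Γ → A` is derivable in `L*(\, !)`; `Γ` may be empty. -/
inductive Derivable : List Tp → Tp → Prop
  | ax (i : ℕ) : Derivable [Tp.prim i] (Tp.prim i)
  | ldivRight {Θ : List Tp} {A B : Tp} :
      Derivable (A :: Θ) B → Derivable Θ (Tp.ldiv A B)
  | ldivLeft {Γ Θ Δ : List Tp} {A B C : Tp} :
      Derivable Θ A → Derivable (Γ ++ [B] ++ Δ) C →
        Derivable (Γ ++ Θ ++ [Tp.ldiv A B] ++ Δ) C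
  | bangLeft {Γ Δ : List Tp} {A B : Tp} :
      Derivable (Γ ++ [A] ++ Δ) B → Derivable (Γ ++ [Tp.bang A] ++ Δ) B
  | weakening {Γ Δ : List Tp} {A B : Tp} :
      Derivable (Γ ++ Δ) B → Derivable (Γ ++ [Tp.bang A] ++ Δ) B

/-- The type `Aₙ \ (Aₙ₋₁ \ … \ (A₁ \ B) …)` attached to the sequent `A₁ … Aₙ → B`. -/
def sequentType (Φ : List Tp) (D : Tp) : Tp :=
  Φ.foldl (fun B A => Tp.ldiv A B) D

/-- The vertices of the tree of a type: its root, and the vertices of the trees of its immediate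
subtypes (a disjoint copy of each). -/
inductive Vertex : Tp → Type
  | root (A : Tp) : Vertex A
  | inBang {A : Tp} (a : Vertex A) : Vertex (Tp.bang A)
  | inLeft {A B : Tp} (a : Vertex A) : Vertex (Tp.ldiv A B)
  | inRight {A B : Tp} (b : Vertex B) : Vertex (Tp.ldiv A B)

/-- The labels `-1`, `1`, `2` of the arcs. -/
inductive ArcLabel : Type
  | neg : ArcLabel
  | pos : ArcLabel
  | two : ArcLabel

namespace Vertex

/-- `Arc a ℓ b`: the tree has an arc with label `ℓ` from `a` to `b` (arcs point to the root). -/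
inductive Arc : {A : Tp} → Vertex A → ArcLabel → Vertex A → Prop
  | bangRoot (A : Tp) : Arc (inBang (root A)) ArcLabel.two (root (Tp.bang A))
  | leftRoot (A B : Tp) : Arc (inLeft (root A)) ArcLabel.neg (root (Tp.ldiv A B))
  | rightRoot (A B : Tp) : Arc (inRight (root B)) ArcLabel.pos (root (Tp.ldiv A B))
  | inBang {A : Tp} {a b : Vertex A} {ℓ : ArcLabel} :
      Arc a ℓ b → Arc (inBang a) ℓ (inBang b)
  | inLeft {A B : Tp} {a b : Vertex A} {ℓ : ArcLabel} :
      Arc a ℓ b → Arc (inLeft (B := B) a) ℓ (inLeft b)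
  | inRight {A B : Tp} {a b : Vertex B} {ℓ : ArcLabel} :
      Arc a ℓ b → Arc (inRight (A := A) a) ℓ (inRight b)

/-- The strict linear order on the vertices. For `!A` the new root is put below the order of `A`;
for `A \ B` it is the reversed order of `A`, followed by the new root, followed by the order
of `B`. -/
def Lt : {A : Tp} → Vertex A → Vertex A → Prop
  | _, root (Tp.bang _), inBang _ => True
  | _, inBang a, inBang b => Lt a b
  | _, inLeft a, inLeft b => Lt b a
  | _, inLeft _, root (Tp.ldiv _ _) => True
  | _, inLeft _, inRight _ => True
  | _, root (Tp.ldiv _ _), inRight _ => True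
  | _, inRight a, inRight b => Lt a b
  | _, _, _ => False

/-- A leaf is a vertex that no arc enters. -/
def IsLeaf {A : Tp} (a : Vertex A) : Prop :=
  ∀ (b : Vertex A) (ℓ : ArcLabel), ¬ Arc b ℓ a

/-- The index of the primitive type that labels a leaf; `none` at the other vertices. -/
def label : {A : Tp} → Vertex A → Option ℕ
  | _, root (Tp.prim i) => some i
  | _, root (Tp.bang _) => none
  | _, root (Tp.ldiv _ _) => none
  | _, inBang a => label a
  | _, inLeft a => label a
  | _, inRight b => label b

/-- `d(a)`: the number of arcs with label `-1` on the path from `a` to the root. -/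
def depth : {A : Tp} → Vertex A → ℕ
  | _, root _ => 0
  | _, inBang a => depth a
  | _, inLeft a => depth a + 1
  | _, inRight b => depth b

/-- `Below a b`: there is a (possibly empty) path from `a` to `b`. -/
def Below {A : Tp} : Vertex A → Vertex A → Prop :=
  Relation.ReflTransGen (fun a b => ∃ ℓ, Arc a ℓ b)

/-- `IsHead h a`: `h` is the leaf from which a path without arcs labelled `-1` leads to `a`,
i.e. `H(a) = h`. -/
def IsHead {A : Tp} (h a : Vertex A) : Prop :=
  IsLeaf h ∧ Relation.ReflTransGen (fun x y => ∃ ℓ, ℓ ≠ ArcLabel.neg ∧ Arc x ℓ y) h a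

/-- Along an arc `a → b`, `d(a)` exceeds `d(b)` by one if the label is `-1` and equals it
otherwise. -/
theorem depth_of_arc {A : Tp} {a b : Vertex A} {ℓ : ArcLabel} (h : Arc a ℓ b) :
    (ℓ = ArcLabel.neg → depth a = depth b + 1) ∧ (ℓ ≠ ArcLabel.neg → depth a = depth b) := by
  induction h <;> simp_all [depth]

/-- Exactly the leaves carry a label. -/
theorem isLeaf_iff_label {A : Tp} (a : Vertex A) : IsLeaf a ↔ ∃ i, label a = some i := by
  induction a with
  | root A =>
    cases A with
    | prim i => exact ⟨fun _ => ⟨i, rfl⟩, fun _ b ℓ h => by cases h⟩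
    | bang A => exact ⟨fun h => absurd (Arc.bangRoot A) (h _ _), fun h => by simp [label] at h⟩
    | ldiv A B => exact ⟨fun h => absurd (Arc.leftRoot A B) (h _ _), fun h => by simp [label] at h⟩
  | inBang a ih =>
    simp only [label]
    rw [← ih]
    exact ⟨fun h b ℓ hb => h _ _ (Arc.inBang hb), fun h b ℓ hb => by
      cases hb with | inBang hb => exact h _ _ hb⟩
  | inLeft a ih =>
    simp only [label]
    rw [← ih]
    exact ⟨fun h b ℓ hb => h _ _ (Arc.inLeft hb), fun h b ℓ hb => by
      cases hb with | inLeft hb => exact h _ _ hb⟩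
  | inRight a ih =>
    simp only [label]
    rw [← ih]
    exact ⟨fun h b ℓ hb => h _ _ (Arc.inRight hb), fun h b ℓ hb => by
      cases hb with | inRight hb => exact h _ _ hb⟩

end Vertex

open Vertex in
/-- A proof net for a type `T`: the labelled ordered tree of `T` together with a set `U` of
vertices and a relation `S` between leaves. -/
structure TypeNet (T : Tp) where
  U : Set (Vertex T)
  S : Vertex T → Vertex T → Prop
  leaf : ∀ a b, S a b → IsLeaf a ∧ IsLeaf b
  symm : ∀ a b, S a b → S b a
  functional : ∀ a b c, S a b → S a c → b = c
  irrefl : ∀ a, ¬ S a a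
  noncrossing : ∀ a b c d, S a b → S c d → Lt a c → Lt c b → Lt a d ∧ Lt d b
  label_eq : ∀ a b, S a b → label a = label b
  depth_eq : ∀ a b, S a b → Lt a b → depth a = depth b + 1
  /-- Here `a'` is `S(a)` and `b'` is `S(b)`. -/
  head : ∀ a a' b b' c, Below a c → IsHead b c → S a a' → S b b' → Lt a b' → Lt b' b →
    ∃ d, Below a' d ∧ IsHead b d
  nonempty : ∃ a b, S a b
  domain : ∀ a, (∃ b, S a b) ↔ IsLeaf a ∧ a ∈ U
  up_closed : ∀ a b ℓ, Arc a ℓ b → b ∉ U → a ∉ U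
  down_closed : ∀ a b ℓ, Arc a ℓ b → a ∉ U → ℓ ≠ ArcLabel.two → b ∉ U
  bang_odd : ∀ (a b : Vertex T) (ℓ : ArcLabel),
    Arc a ℓ b → Even (depth b) → ℓ ≠ ArcLabel.two

/-- A proof net for the sequent `Φ → D` is a proof net for the type attached to it. -/
abbrev ProofNet (Φ : List Tp) (D : Tp) : Type :=
  TypeNet (sequentType Φ D)

end LambekBang

/-! By `up_closed` and `down_closed`, membership in `U` changes only across arcs with label 2, and
the root is in `U` because `S` is nonempty. So discarding the leaves outside `U` only empties some
occurrences of `!A`, which weakening can restore, and on the remaining leaves `S` is a total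
noncrossing matching. In this form (`IsNet`) a net yields a derivation by induction on the size of
the sequent (`IsNet.derivable`).

A division on the right moves to the antecedent without changing the order of leaves; an outermost
`!` on the left is undone by `bangLeft` or `weakening`; `bang_odd` excludes `!` as the goal. What
remains is a primitive goal `y₀` and an antecedent of leaves and divisions. It is an axiom, or it
has the form `Γ (X \ B) Δ` with `Δ` empty or a single leaf (`IsNet.eq_singleton_or_ldiv`).

The crux is to find `Γ = Γ₁ Θ` such that the leaves of `X` and `Θ` are matched among themselves
(`IsNet.exists_split`). In the tree the blocks occur in the order `Δ, B, X, Θ, Γ₁, y₀`. Let `Θ` be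
the longest suffix of `Γ` whose heads are all matched to the left, but not into `Δ` or `B`. A link
leaving `X, Θ` to the right is excluded by depth at `y₀`, or by the head of the last member of `Γ₁`,
which violates the defining property of `Θ`. A link leaving to the left ends in an argument `Y` of
`B`. The head of `Y` is matched into `Γ₁`, which crosses the link, or to the left, and then the head
condition makes `Y` closed (`IsNet.arg_closed`).

Restriction gives the premise `Γ₁ B Δ → y₀`. The premise `Θ → X` needs a rotation of the order, with
the depths in `X` lowered by two (`IsMatching.rotate`). -/

namespace LambekBang

/-! ### Types with named leaves -/

/-- A type whose leaves are named by elements of `α`; `weak A` stands for an occurrence of `!A`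
whose content does not take part in the net. -/
inductive DTp (α : Type) : Type
  | leaf (i : ℕ) (x : α) : DTp α
  | bang (A : DTp α) : DTp α
  | weak (A : Tp) : DTp α
  | ldiv (A B : DTp α) : DTp α

namespace DTp

variable {α : Type}

/-- The underlying type. -/
def erase : DTp α → Tp
  | leaf i _ => Tp.prim i
  | bang A => Tp.bang A.erase
  | weak A => Tp.bang A
  | ldiv A B => Tp.ldiv A.erase B.erase

/-- The leaves, in the order of the tree. -/
def word : DTp α → List α
  | leaf _ x => [x]
  | bang A => A.word
  | weak _ => []
  | ldiv A B => A.word.reverse ++ B.word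

/-- The head, if it takes part in the net. -/
def head? : DTp α → Option α
  | leaf _ x => some x
  | bang A => A.head?
  | weak _ => none
  | ldiv _ B => B.head?

/-- The arguments hanging on the path from the head to the root, the outermost one first. -/
def args : DTp α → List (DTp α)
  | leaf _ _ => []
  | bang A => A.args
  | weak _ => []
  | ldiv A B => A :: B.args

def size : DTp α → ℕ
  | leaf _ _ => 1
  | bang A => A.size + 1
  | weak _ => 1
  | ldiv A B => A.size + B.size + 1

/-- Labels and depths are those of the tree, where the root has depth `k`, and `!` occurs at odd
depth only. -/
def WellFormed (lab : α → Option ℕ) (dep : α → ℕ) : ℕ → DTp α → Prop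
  | k, leaf i x => lab x = some i ∧ dep x = k
  | k, bang A => Odd k ∧ WellFormed lab dep k A
  | k, weak _ => Odd k
  | k, ldiv A B => WellFormed lab dep (k + 1) A ∧ WellFormed lab dep k B

/-- The head condition on nets for the subtree `A`. -/
def HeadCond (s : α → α) (pos : α → ℕ) (A : DTp α) : Prop :=
  ∀ x, A.head? = some x → ∀ a ∈ A.word, pos a < pos (s x) → pos (s x) < pos x → s a ∈ A.word

/-- The head condition for all subtrees that are left arguments. -/
def ArgsHeadCond (s : α → α) (pos : α → ℕ) : DTp α → Prop
  | leaf _ _ => True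
  | bang A => ArgsHeadCond s pos A
  | weak _ => True
  | ldiv A B => HeadCond s pos A ∧ ArgsHeadCond s pos A ∧ ArgsHeadCond s pos B

variable {s : α → α} {pos pos' : α → ℕ} {lab : α → Option ℕ} {dep dep' : α → ℕ}

theorem head?_mem {A : DTp α} {x : α} (h : A.head? = some x) : x ∈ A.word := by
  induction A with
  | leaf i y => simp_all [head?, word]
  | bang A ih => exact ih h
  | weak A => simp [head?] at h
  | ldiv A B _ ih => exact List.mem_append_right _ (ih h)

theorem WellFormed.le_dep {A : DTp α} {k : ℕ} (h : A.WellFormed lab dep k) {x : α}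
    (hx : x ∈ A.word) : k ≤ dep x := by
  induction A generalizing k with
  | leaf i y => simp_all [WellFormed, word]
  | bang A ih => exact ih h.2 hx
  | weak A => simp [word] at hx
  | ldiv A B ihA ihB =>
    rcases List.mem_append.1 hx with hx | hx
    · have := ihA h.1 (List.mem_reverse.1 hx)
      omega
    · exact ihB h.2 hx

theorem WellFormed.dep_head {A : DTp α} {k : ℕ} (h : A.WellFormed lab dep k) {x : α}
    (hx : A.head? = some x) : dep x = k := by
  induction A generalizing k with
  | leaf i y => simp_all [WellFormed, head?]
  | bang A ih => exact ih h.2 hx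
  | weak A => simp [head?] at hx
  | ldiv A B ihA ihB => exact ihB h.2 hx

theorem WellFormed.head?_of_dep {A : DTp α} {k : ℕ} (h : A.WellFormed lab dep k) {x : α}
    (hx : x ∈ A.word) (hd : dep x = k) : A.head? = some x := by
  induction A generalizing k with
  | leaf i y => simp_all [word, head?]
  | bang A ih => exact ih h.2 hx hd
  | weak A => simp [word] at hx
  | ldiv A B ihA ihB =>
    rcases List.mem_append.1 hx with hx | hx
    · have := h.1.le_dep (List.mem_reverse.1 hx)
      omega
    · exact ihB h.2 hx hd

/-- The path from the root to the head keeps the even depth, and at even depth there is no `!`,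
hence no `weak` to hide the head. -/
theorem WellFormed.exists_head {A : DTp α} {k : ℕ} (h : A.WellFormed lab dep k) (hk : Even k) :
    ∃ x, A.head? = some x := by
  induction A generalizing k with
  | leaf i y => exact ⟨y, rfl⟩
  | bang A ih => exact absurd hk (Nat.not_even_iff_odd.2 h.1)
  | weak A => exact absurd hk (Nat.not_even_iff_odd.2 h)
  | ldiv A B ihA ihB => exact ihB h.2 hk

theorem WellFormed.shift {A : DTp α} {k : ℕ} (h : A.WellFormed lab dep (k + 2))
    (hd : ∀ x ∈ A.word, dep' x + 2 = dep x) : A.WellFormed lab dep' k := by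
  induction A generalizing k with
  | leaf i y =>
    have h1 := hd y (by simp [word])
    have h2 := h.2
    exact ⟨h.1, by omega⟩
  | bang A ih => exact ⟨by have := h.1; grind, ih h.2 hd⟩
  | weak A =>
    have h1 : Odd (k + 2) := h
    show Odd k
    grind
  | ldiv A B ihA ihB =>
    exact ⟨ihA h.1 fun x hx => hd x (List.mem_append_left _ (List.mem_reverse.2 hx)),
      ihB h.2 fun x hx => hd x (List.mem_append_right _ hx)⟩

theorem WellFormed.congr {A : DTp α} {k : ℕ} (h : A.WellFormed lab dep k)
    (hd : ∀ x ∈ A.word, dep' x = dep x) : A.WellFormed lab dep' k := by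
  induction A generalizing k with
  | leaf i y => exact ⟨h.1, (hd y (by simp [word])).trans h.2⟩
  | bang A ih => exact ⟨h.1, ih h.2 hd⟩
  | weak A => exact h
  | ldiv A B ihA ihB =>
    exact ⟨ihA h.1 fun x hx => hd x (List.mem_append_left _ (List.mem_reverse.2 hx)),
      ihB h.2 fun x hx => hd x (List.mem_append_right _ hx)⟩

/-- The order enters the head condition only through its premise, so it suffices that each new
instance of the premise is an old one. -/
theorem ArgsHeadCond.mono {A : DTp α} (h : A.ArgsHeadCond s pos)
    (hp : ∀ a ∈ A.word, ∀ x ∈ A.word, pos' a < pos' (s x) → pos' (s x) < pos' x →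
      pos a < pos (s x) ∧ pos (s x) < pos x) : A.ArgsHeadCond s pos' := by
  induction A with
  | leaf i y => trivial
  | bang A ih => exact ih h hp
  | weak A => trivial
  | ldiv A B ihA ihB =>
    have hA : ∀ x ∈ A.word, x ∈ (ldiv A B).word := fun x hx =>
      List.mem_append_left _ (List.mem_reverse.2 hx)
    have hB : ∀ x ∈ B.word, x ∈ (ldiv A B).word := fun x hx => List.mem_append_right _ hx
    refine ⟨fun x hx a ha h1 h2 => ?_, ihA h.2.1 fun a ha x hx => hp a (hA a ha) x (hA x hx),
      ihB h.2.2 fun a ha x hx => hp a (hB a ha) x (hB x hx)⟩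
    have h3 := hp a (hA a ha) x (hA x (head?_mem hx)) h1 h2
    exact h.1 x hx a ha h3.1 h3.2

/-- The head is the last leaf of the word. For antecedent members, whose words are decreasing, it is
the least leaf instead. -/
theorem le_head {A : DTp α} (h : A.word.Pairwise (pos · < pos ·)) {x a : α}
    (hx : A.head? = some x) (ha : a ∈ A.word) : pos a ≤ pos x := by
  induction A with
  | leaf i y => simp_all [word, head?]
  | bang A ih => exact ih h hx ha
  | weak A => simp [head?] at hx
  | ldiv A B ihA ihB =>
    rw [word, List.pairwise_append] at h
    rcases List.mem_append.1 ha with ha | ha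
    · exact (h.2.2 a ha x (head?_mem hx)).le
    · exact ihB h.2.1 hx ha

theorem head?_or_mem_args {A : DTp α} {x : α} (hx : x ∈ A.word) :
    A.head? = some x ∨ ∃ Y ∈ A.args, x ∈ Y.word := by
  induction A with
  | leaf i y => simp_all [word, head?]
  | bang A ih => exact ih hx
  | weak A => simp [word] at hx
  | ldiv A B ihA ihB =>
    rcases List.mem_append.1 hx with hx | hx
    · exact Or.inr ⟨A, by simp [args], List.mem_reverse.1 hx⟩
    · rcases ihB hx with h | ⟨Y, hY, h⟩
      · exact Or.inl h
      · exact Or.inr ⟨Y, by simp [args, hY], h⟩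

theorem word_subset_of_mem_args {A Y : DTp α} (hY : Y ∈ A.args) {x : α} (hx : x ∈ Y.word) :
    x ∈ A.word := by
  induction A with
  | leaf i y => simp [args] at hY
  | bang A ih => exact ih hY
  | weak A => simp [args] at hY
  | ldiv A B ihA ihB =>
    rcases List.mem_cons.1 hY with rfl | hY
    · exact List.mem_append_left _ (List.mem_reverse.2 hx)
    · exact List.mem_append_right _ (ihB hY)

theorem WellFormed.of_mem_args {A Y : DTp α} {k : ℕ} (h : A.WellFormed lab dep k)
    (hY : Y ∈ A.args) : Y.WellFormed lab dep (k + 1) := by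
  induction A with
  | leaf i y => simp [args] at hY
  | bang A ih => exact ih h.2 hY
  | weak A => simp [args] at hY
  | ldiv A B ihA ihB =>
    rcases List.mem_cons.1 hY with rfl | hY
    · exact h.1
    · exact ihB h.2 hY

theorem ArgsHeadCond.of_mem_args {A Y : DTp α} (h : A.ArgsHeadCond s pos)
    (hY : Y ∈ A.args) : Y.HeadCond s pos := by
  induction A with
  | leaf i y => simp [args] at hY
  | bang A ih => exact ih h hY
  | weak A => simp [args] at hY
  | ldiv A B ihA ihB =>
    rcases List.mem_cons.1 hY with rfl | hY
    · exact h.1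
    · exact ihB h.2.2 hY

theorem pairwise_of_mem_args {A Y : DTp α} (h : A.word.Pairwise (pos · > pos ·))
    (hY : Y ∈ A.args) : Y.word.Pairwise (pos · < pos ·) := by
  induction A with
  | leaf i y => simp [args] at hY
  | bang A ih => exact ih h hY
  | weak A => simp [args] at hY
  | ldiv A B ihA ihB =>
    rw [word, List.pairwise_append, List.pairwise_reverse] at h
    rcases List.mem_cons.1 hY with rfl | hY
    · exact h.1
    · exact ihB h.2.1 hY

theorem head_lt_of_mem_args {A Y : DTp α} (h : A.word.Pairwise (pos · > pos ·))
    (hY : Y ∈ A.args) {x a : α} (hx : A.head? = some x) (ha : a ∈ Y.word) : pos x < pos a := by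
  induction A with
  | leaf i y => simp [args] at hY
  | bang A ih => exact ih h hY hx
  | weak A => simp [args] at hY
  | ldiv A B ihA ihB =>
    rw [word, List.pairwise_append] at h
    rcases List.mem_cons.1 hY with rfl | hY
    · exact h.2.2 a (List.mem_reverse.2 ha) x (head?_mem hx)
    · exact ihB h.2.1 hY hx

/-- The arguments occupy disjoint intervals of the word. -/
theorem mem_of_between {A Y : DTp α} (h : A.word.Pairwise (pos · > pos ·))
    (hY : Y ∈ A.args) {a b z : α} (ha : a ∈ Y.word) (hb : b ∈ Y.word) (hz : z ∈ A.word)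
    (haz : pos a < pos z) (hzb : pos z < pos b) : z ∈ Y.word := by
  induction A with
  | leaf i y => simp [args] at hY
  | bang A ih => exact ih h hY hz
  | weak A => simp [args] at hY
  | ldiv A B ihA ihB =>
    rw [word, List.pairwise_append] at h
    rcases List.mem_cons.1 hY with rfl | hY <;> rcases List.mem_append.1 hz with hz | hz
    · exact List.mem_reverse.1 hz
    · have := h.2.2 a (List.mem_reverse.2 ha) z hz
      omega
    · have := h.2.2 z hz b (word_subset_of_mem_args hY hb)
      omega
    · exact ihB h.2.1 hY hz

theorem args_eq_of_mem {A Y Z : DTp α} (h : A.word.Pairwise (pos · > pos ·))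
    (hY : Y ∈ A.args) (hZ : Z ∈ A.args) {z : α} (hzY : z ∈ Y.word) (hzZ : z ∈ Z.word) :
    Y = Z := by
  induction A with
  | leaf i y => simp [args] at hY
  | bang A ih => exact ih h hY hZ
  | weak A => simp [args] at hY
  | ldiv A B ihA ihB =>
    rw [word, List.pairwise_append] at h
    rcases List.mem_cons.1 hY with rfl | hY' <;> rcases List.mem_cons.1 hZ with rfl | hZ'
    · rfl
    · exact absurd (h.2.2 z (List.mem_reverse.2 hzY) z (word_subset_of_mem_args hZ' hzZ))
        (lt_irrefl _)
    · exact absurd (h.2.2 z (List.mem_reverse.2 hzZ) z (word_subset_of_mem_args hY' hzY))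
        (lt_irrefl _)
    · exact ihB h.2.1 hY' hZ'

end DTp

/-! ### Nets as matchings of the leaves of a sequent -/

variable {α : Type} {s : α → α} {pos pos' : α → ℕ} {lab : α → Option ℕ} {dep dep' : α → ℕ}

/-- The leaves of an antecedent. -/
def ctxWord (Φ : List (DTp α)) : List α := Φ.flatMap DTp.word

theorem mem_ctxWord {Φ : List (DTp α)} {x : α} : x ∈ ctxWord Φ ↔ ∃ A ∈ Φ, x ∈ A.word :=
  List.mem_flatMap

@[simp] theorem ctxWord_nil : ctxWord ([] : List (DTp α)) = [] := rfl

@[simp] theorem ctxWord_cons (A : DTp α) (Φ : List (DTp α)) :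
    ctxWord (A :: Φ) = A.word ++ ctxWord Φ := by simp [ctxWord]

@[simp] theorem ctxWord_append (Φ Ψ : List (DTp α)) :
    ctxWord (Φ ++ Ψ) = ctxWord Φ ++ ctxWord Ψ := by simp [ctxWord]

/-- The leaves of a sequent, in the order of its tree. -/
def seqWord (Φ : List (DTp α)) (D : DTp α) : List α := (ctxWord Φ).reverse ++ D.word

/-- `s` is a noncrossing matching of the leaves in `l` that respects labels and depths. -/
structure IsMatching (s : α → α) (lab : α → Option ℕ) (pos dep : α → ℕ) (l : List α) : Prop where
  closed : ∀ x ∈ l, s x ∈ l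
  invol : ∀ x ∈ l, s (s x) = x
  pos_ne : ∀ x ∈ l, pos (s x) ≠ pos x
  lab_eq : ∀ x ∈ l, lab (s x) = lab x
  depth_eq : ∀ x ∈ l, pos x < pos (s x) → dep x = dep (s x) + 1
  noncrossing : ∀ a ∈ l, ∀ c ∈ l, pos a < pos c → pos c < pos (s a) →
    pos a < pos (s c) ∧ pos (s c) < pos (s a)

theorem IsMatching.depth_eq' {l : List α} (h : IsMatching s lab pos dep l) {x : α} (hx : x ∈ l)
    (hlt : pos (s x) < pos x) : dep (s x) = dep x + 1 := by
  have := h.depth_eq (s x) (h.closed x hx)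
  rw [h.invol x hx] at this
  exact this hlt

theorem IsMatching.restrict {l l' : List α} (h : IsMatching s lab pos dep l)
    (hl : ∀ x ∈ l', x ∈ l) (hc : ∀ x ∈ l', s x ∈ l') : IsMatching s lab pos dep l' where
  closed := hc
  invol x hx := h.invol x (hl x hx)
  pos_ne x hx := h.pos_ne x (hl x hx)
  lab_eq x hx := h.lab_eq x (hl x hx)
  depth_eq x hx := h.depth_eq x (hl x hx)
  noncrossing a ha c hc := h.noncrossing a (hl a ha) c (hl c hc)

/-- Moving an initial segment to the end, with depths lowered by two, preserves matchings. -/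
theorem IsMatching.rotate {u v : List α} (h : IsMatching s lab pos dep (u ++ v)) {N : ℕ}
    (huv : ∀ x ∈ u, ∀ y ∈ v, pos x < pos y) (hN : ∀ y ∈ v, pos y < N)
    (hinj : ∀ x ∈ u ++ v, ∀ y ∈ u ++ v, pos x = pos y → x = y)
    (hu : ∀ x ∈ u, pos' x = pos x + N ∧ dep' x + 2 = dep x)
    (hv : ∀ x ∈ v, pos' x = pos x ∧ dep' x = dep x) :
    IsMatching s lab pos' dep' (v ++ u) := by
  have h := h.restrict (l' := v ++ u) (fun x hx => by simp at hx ⊢; tauto)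
    (fun x hx => by have := h.closed x (by simp at hx ⊢; tauto); simp at this ⊢; tauto)
  have hinj : ∀ x ∈ v ++ u, ∀ y ∈ v ++ u, pos x = pos y → x = y := fun x hx y hy =>
    hinj x (by simp at hx ⊢; tauto) y (by simp at hy ⊢; tauto)
  refine ⟨h.closed, h.invol, fun x hx => ?_, h.lab_eq, fun x hx hlt => ?_,
    fun a ha c hc h1 h2 => ?_⟩
  · have h1 := h.pos_ne x hx
    rcases List.mem_append.1 hx with hx' | hx' <;>
    rcases List.mem_append.1 (h.closed x hx) with hy | hy
    · have := hv _ hx'; have := hv _ hy; omega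
    · have := hv _ hx'; have := hu _ hy; have := hN _ hx'; omega
    · have := hu _ hx'; have := hv _ hy; have := hN _ hy; omega
    · have := hu _ hx'; have := hu _ hy; omega
  · have h1 := h.depth_eq x hx
    have h2 := h.depth_eq' hx
    rcases List.mem_append.1 hx with hx' | hx' <;>
    rcases List.mem_append.1 (h.closed x hx) with hy | hy
    · have := hv _ hx'; have := hv _ hy; omega
    · have := hv _ hx'; have := hu _ hy; have := huv _ hy _ hx'; omega
    · have := hu _ hx'; have := hv _ hy; have := hN _ hy; omega
    · have := hu _ hx'; have := hu _ hy; omega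
  -- Crossing is invariant under cyclic rotation. Either endpoint of each link may come first in the
  -- old order, so the old condition is instantiated at every choice of endpoints.
  · have hsa := h.closed a ha
    have hsc := h.closed c hc
    have ia := h.invol a ha
    have ic := h.invol c hc
    have n1 := h.noncrossing a ha c hc
    have n2 := h.noncrossing _ hsa c hc
    have n3 := h.noncrossing a ha _ hsc
    have n4 := h.noncrossing _ hsa _ hsc
    have m1 := h.noncrossing c hc a ha
    have m2 := h.noncrossing _ hsc a ha
    have m3 := h.noncrossing c hc _ hsa
    have m4 := h.noncrossing _ hsc _ hsa
    rw [ia] at n2 n4 m3 m4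
    rw [ic] at n3 n4 m2 m4
    have e1 : pos (s c) = pos a → c = s a := fun e => by rw [← ic, hinj _ hsc _ ha e]
    have e2 : pos (s c) = pos (s a) → c = a := fun e => by rw [← ic, hinj _ hsc _ hsa e, ia]
    have e3 : pos (s c) ≠ pos a := fun e => by
      have := e1 e
      rw [this] at h2
      exact lt_irrefl _ h2
    have e4 : pos (s c) ≠ pos (s a) := fun e => by
      have := e2 e
      rw [this] at h1
      exact lt_irrefl _ h1
    have side : ∀ x ∈ v ++ u, (pos' x = pos x ∧ pos' x < N) ∨ (pos' x = pos x + N) := fun x hx => by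
      rcases List.mem_append.1 hx with hx | hx
      · have := hv x hx; have := hN x hx; omega
      · exact Or.inr (hu x hx).1
    have cross : ∀ x ∈ v ++ u, ∀ y ∈ v ++ u, pos' x < N → N ≤ pos' y → pos y < pos x :=
      fun x hx y hy hx' hy' => by
        rcases List.mem_append.1 hx with hx | hx <;> rcases List.mem_append.1 hy with hy | hy
        · have := hv y hy; have := hN y hy; omega
        · exact huv y hy x hx
        · have := hu x hx; omega
        · have := hu x hx; omega
    have s1 := side _ ha
    have s2 := side _ hc
    have s3 := side _ hsa
    have s4 := side _ hsc
    have p1 := cross _ ha _ hc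
    have p2 := cross _ hc _ hsa
    have p3 := cross _ ha _ hsa
    have p4 := cross _ ha _ hsc
    have p5 := cross _ hsc _ hsa
    have p6 := cross _ hc _ hsc
    have p7 := cross _ hsc _ ha
    have p8 := cross _ hsc _ hc
    have q1 := h.pos_ne a ha
    have q2 := h.pos_ne c hc
    clear side cross e1 e2
    omega

/-- A net for the sequent `Φ → D`, presented by the matching of its leaves. -/
structure IsNet (s : α → α) (lab : α → Option ℕ) (pos dep : α → ℕ) (Φ : List (DTp α))
    (D : DTp α) : Prop where
  sorted : (seqWord Φ D).Pairwise (pos · < pos ·)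
  matching : IsMatching s lab pos dep (seqWord Φ D)
  ctx_wf : ∀ A ∈ Φ, A.WellFormed lab dep 1
  goal_wf : D.WellFormed lab dep 0
  ctx_head : ∀ A ∈ Φ, A.ArgsHeadCond s pos
  goal_head : D.ArgsHeadCond s pos

theorem mem_seqWord {Φ : List (DTp α)} {D : DTp α} {x : α} :
    x ∈ seqWord Φ D ↔ x ∈ ctxWord Φ ∨ x ∈ D.word := by
  simp [seqWord]

theorem seqWord_ldiv (Φ : List (DTp α)) (A B : DTp α) :
    seqWord Φ (DTp.ldiv A B) = seqWord (A :: Φ) B := by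
  simp [seqWord, DTp.word]

theorem IsNet.of_ldiv {Φ : List (DTp α)} {A B : DTp α}
    (h : IsNet s lab pos dep Φ (DTp.ldiv A B)) : IsNet s lab pos dep (A :: Φ) B where
  sorted := seqWord_ldiv Φ A B ▸ h.sorted
  matching := seqWord_ldiv Φ A B ▸ h.matching
  ctx_wf := List.forall_mem_cons.2 ⟨h.goal_wf.1, h.ctx_wf⟩
  goal_wf := h.goal_wf.2
  ctx_head := List.forall_mem_cons.2 ⟨h.goal_head.2.1, h.ctx_head⟩
  goal_head := h.goal_head.2.2

theorem IsNet.of_bang {Γ Δ : List (DTp α)} {A D : DTp α}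
    (h : IsNet s lab pos dep (Γ ++ [DTp.bang A] ++ Δ) D) :
    IsNet s lab pos dep (Γ ++ [A] ++ Δ) D := by
  have e : seqWord (Γ ++ [DTp.bang A] ++ Δ) D = seqWord (Γ ++ [A] ++ Δ) D := by
    simp [seqWord, DTp.word]
  have h1 := h.ctx_wf
  have h2 := h.ctx_head
  simp only [List.append_assoc, List.forall_mem_append, List.forall_mem_singleton] at h1 h2
  refine ⟨e ▸ h.sorted, e ▸ h.matching, ?_, h.goal_wf, ?_, h.goal_head⟩ <;>
    simp only [List.append_assoc, List.forall_mem_append, List.forall_mem_singleton]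
  exacts [⟨h1.1, h1.2.1.2, h1.2.2⟩, ⟨h2.1, h2.2.1, h2.2.2⟩]

theorem IsNet.of_weak {Γ Δ : List (DTp α)} {A : Tp} {D : DTp α}
    (h : IsNet s lab pos dep (Γ ++ [DTp.weak A] ++ Δ) D) : IsNet s lab pos dep (Γ ++ Δ) D := by
  have e : seqWord (Γ ++ [DTp.weak A] ++ Δ) D = seqWord (Γ ++ Δ) D := by
    simp [seqWord, DTp.word]
  have h1 := h.ctx_wf
  have h2 := h.ctx_head
  simp only [List.append_assoc, List.forall_mem_append, List.forall_mem_singleton] at h1 h2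
  refine ⟨e ▸ h.sorted, e ▸ h.matching, ?_, h.goal_wf, ?_, h.goal_head⟩ <;>
    simp only [List.forall_mem_append]
  exacts [⟨h1.1, h1.2.2⟩, ⟨h2.1, h2.2.2⟩]

theorem IsNet.pos_injOn {Φ : List (DTp α)} {D : DTp α} (h : IsNet s lab pos dep Φ D) :
    ∀ x ∈ seqWord Φ D, ∀ y ∈ seqWord Φ D, pos x = pos y → x = y := by
  intro x hx y hy e
  by_contra hne
  have hs := List.pairwise_iff_getElem.1 h.sorted
  obtain ⟨i, hi, rfl⟩ := List.getElem_of_mem hx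
  obtain ⟨j, hj, rfl⟩ := List.getElem_of_mem hy
  rcases lt_trichotomy i j with hij | rfl | hij
  · have := hs i j hi hj hij
    omega
  · exact hne rfl
  · have := hs j i hj hi hij
    omega

/-- There is a maximal suffix of a list whose elements satisfy `P`. -/
theorem exists_maximal_suffix {β : Type} (P : β → Prop) (l : List β) :
    ∃ l₁ l₂, l = l₁ ++ l₂ ∧ (∀ x ∈ l₂, P x) ∧ (l₁ = [] ∨ ∃ l₃ x, l₁ = l₃ ++ [x] ∧ ¬ P x) := by
  induction l using List.reverseRecOn with
  | nil => exact ⟨[], [], by simp⟩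
  | append_singleton l x ih =>
    by_cases hx : P x
    · obtain ⟨l₁, l₂, rfl, h2, h1⟩ := ih
      refine ⟨l₁, l₂ ++ [x], by simp, fun y hy => ?_, h1⟩
      rcases List.mem_append.1 hy with hy | hy
      · exact h2 y hy
      · rwa [List.mem_singleton.1 hy]
    · exact ⟨l ++ [x], [], by simp, by simp, Or.inr ⟨l, x, rfl, hx⟩⟩

/-! ### Splitting the antecedent at a division -/

section Split

variable {Γ Δ : List (DTp α)} {E : DTp α} {i : ℕ} {y₀ : α}

theorem IsNet.order (h : IsNet s lab pos dep (Γ ++ [E] ++ Δ) (DTp.leaf i y₀)) :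
    (∀ u ∈ ctxWord Δ, ∀ v ∈ E.word, pos u < pos v) ∧
    (∀ v ∈ E.word, ∀ w ∈ ctxWord Γ, pos v < pos w) ∧
    (∀ u ∈ ctxWord Δ, ∀ w ∈ ctxWord Γ, pos u < pos w) ∧
    (∀ u ∈ ctxWord (Γ ++ [E] ++ Δ), pos u < pos y₀) ∧
    E.word.Pairwise (pos · > pos ·) ∧ (ctxWord Γ).Pairwise (pos · > pos ·) ∧
    (ctxWord Δ).Pairwise (pos · > pos ·) := by
  have := h.sorted
  simp only [seqWord, ctxWord_append, ctxWord_cons, ctxWord_nil, List.append_nil,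
    List.pairwise_append, List.pairwise_reverse, List.mem_reverse, DTp.word,
    List.mem_append, List.mem_singleton, forall_eq] at this ⊢
  grind

/-- Leaves of `Δ` and `E` are of depth one or lie in an argument of `E`. -/
theorem IsNet.args_facts (h : IsNet s lab pos dep (Γ ++ [E] ++ Δ) (DTp.leaf i y₀))
    (hΔ : ∀ z ∈ ctxWord Δ, dep z = 1) {z : α} (hz : z ∈ ctxWord Δ ∨ z ∈ E.word) :
    (dep z ≠ 1 → ∃ Y ∈ E.args, z ∈ Y.word) ∧
      (dep z = 1 → ∀ Y ∈ E.args, ∀ a ∈ Y.word, pos z < pos a) := by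
  obtain ⟨o1, -, -, -, oE, -⟩ := h.order
  have hE : E.WellFormed lab dep 1 := h.ctx_wf E (by simp)
  constructor
  · intro hd
    rcases hz with hz | hz
    · exact absurd (hΔ z hz) hd
    · rcases DTp.head?_or_mem_args hz with hh | hY
      · exact absurd (hE.dep_head hh) hd
      · exact hY
  · intro hd Y hY a ha
    rcases hz with hz | hz
    · exact o1 z hz a (DTp.word_subset_of_mem_args hY ha)
    · exact DTp.head_lt_of_mem_args oE hY (hE.head?_of_dep hz hd) ha

/-- An argument of `E` whose head is matched to the left is matched with itself. -/
theorem IsNet.arg_closed (h : IsNet s lab pos dep (Γ ++ [E] ++ Δ) (DTp.leaf i y₀))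
    (hΔ : ∀ z ∈ ctxWord Δ, dep z = 1) {Y : DTp α} (hY : Y ∈ E.args) {y : α}
    (hy : Y.head? = some y) (hlt : pos (s y) < pos y) {a : α} (ha : a ∈ Y.word) :
    s a ∈ Y.word := by
  obtain ⟨o1, o2, o3, o4, oE, -, -⟩ := h.order
  have hE : E.WellFormed lab dep 1 := h.ctx_wf E (by simp)
  have hH : E.ArgsHeadCond s pos := h.ctx_head E (by simp)
  have M := h.matching
  have inE : ∀ z ∈ E.word, z ∈ seqWord (Γ ++ [E] ++ Δ) (DTp.leaf i y₀) := fun z hz => by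
    simp [mem_seqWord, hz]
  have hyY := DTp.head?_mem hy
  have hyE := DTp.word_subset_of_mem_args hY hyY
  have hyl := inE y hyE
  have left : ∀ z ∈ seqWord (Γ ++ [E] ++ Δ) (DTp.leaf i y₀), pos z < pos y →
      z ∈ ctxWord Δ ∨ z ∈ E.word := fun z hz hzy => by
    rcases mem_seqWord.1 hz with hz | hz
    · simp only [ctxWord_append, ctxWord_cons, ctxWord_nil, List.append_nil,
        List.mem_append] at hz
      rcases hz with (hz | hz) | hz
      · have := o2 y hyE z hz
        omega
      · exact Or.inr hz
      · exact Or.inl hz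
    · have := o4 y (by simp [hyE])
      rw [List.mem_singleton.1 hz] at hzy
      omega
  have between : ∀ Z ∈ E.args, ∀ u ∈ Z.word, ∀ w ∈ Z.word,
      ∀ z ∈ seqWord (Γ ++ [E] ++ Δ) (DTp.leaf i y₀), pos z ≤ pos y → pos u < pos z →
      pos z < pos w → z ∈ Z.word := fun Z hZ u hu w hw z hz hzy h1 h2 => by
    refine DTp.mem_of_between oE hZ hu hw ?_ h1 h2
    rcases hzy.lt_or_eq with hzy | hzy
    · refine (left z hz hzy).resolve_left fun hz' => ?_
      have := o1 z hz' u (DTp.word_subset_of_mem_args hZ hu)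
      omega
    · rwa [h.pos_injOn z hz y hyl hzy]
  have hsy := M.closed y hyl
  have dy : dep y = 2 := (hE.of_mem_args hY).dep_head hy
  have dsy := M.depth_eq' hyl hlt
  -- The partner of `y` has depth 3 and lies to the left, so it belongs to some argument `Z`. The
  -- rest shows `Z = Y` and then closedness.
  obtain ⟨Z, hZ, hsyZ⟩ := (h.args_facts hΔ (left _ hsy hlt)).1 (by omega)
  have hZwf := hE.of_mem_args hZ
  obtain ⟨z, hz⟩ := hZwf.exists_head (by decide)
  have hzZ := DTp.head?_mem hz
  have dz : dep z = 2 := hZwf.dep_head hz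
  have hzl := inE z (DTp.word_subset_of_mem_args hZ hzZ)
  by_cases hyZ : y ∈ Z.word
  · obtain rfl := DTp.args_eq_of_mem oE hY hZ hyY hyZ
    have hal := inE a (DTp.word_subset_of_mem_args hY ha)
    have hle := DTp.le_head (DTp.pairwise_of_mem_args oE hY) hy ha
    rcases hle.lt_or_eq with hay | hay
    -- Left of `s y` the head condition applies; between `s y` and `y` the noncrossing condition
    -- keeps the partner inside the interval of `Y`.
    · rcases lt_trichotomy (pos a) (pos (s y)) with h1 | h1 | h1
      · exact hH.of_mem_args hY y hy a ha h1 hlt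
      · rw [h.pos_injOn a hal _ hsy h1, M.invol y hyl]
        exact hyY
      · have := M.noncrossing (s y) hsy a hal h1 (by rwa [M.invol y hyl])
        rw [M.invol y hyl] at this
        exact between Y hY _ hsyZ _ hyY _ (M.closed a hal) this.2.le this.1 this.2
    · rwa [h.pos_injOn a hal y hyl hay]
  -- If `Z` differs from `Y`, its head `z` lies strictly between `s y` and `y`, and so does `s z`.
  -- Then `z` is matched to the left, and the head condition for `Z` at `s y` puts `y` into `Z`.
  · exfalso
    apply hyZ
    have h1 := DTp.le_head (DTp.pairwise_of_mem_args oE hZ) hz hsyZ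
    have h2 : pos (s y) ≠ pos z := fun e => by
      have := h.pos_injOn _ hsy _ hzl e
      rw [this] at dsy
      omega
    have h3 : pos z < pos y := by
      by_contra hcon
      rcases (not_lt.1 hcon).lt_or_eq with hc | hc
      · exact hyZ (between Z hZ _ hsyZ _ hzZ y hyl le_rfl hlt hc)
      · rw [h.pos_injOn y hyl z hzl hc] at hyZ
        exact hyZ hzZ
    have h4 := M.noncrossing (s y) hsy z hzl (by omega) (by rwa [M.invol y hyl])
    rw [M.invol y hyl] at h4
    -- Otherwise `s z` has depth 1; left of `y` such leaves lie in `Δ` or are the head of `E`, hence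
    -- precede every argument, including `s y`.
    have h5 : pos (s z) < pos z := by
      by_contra hcon
      have hne := M.pos_ne z hzl
      have d1 := M.depth_eq z hzl (by omega)
      have := (h.args_facts hΔ (left _ (M.closed z hzl) h4.2)).2 (by omega) Z hZ _ hsyZ
      omega
    have := hH.of_mem_args hZ z hz (s y) hsyZ h4.1 h5
    rwa [M.invol y hyl] at this

theorem IsNet.exists_split {X B : DTp α}
    (h : IsNet s lab pos dep (Γ ++ [DTp.ldiv X B] ++ Δ) (DTp.leaf i y₀))
    (hΔ : ∀ z ∈ ctxWord Δ, dep z = 1) :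
    ∃ Γ₁ Θ, Γ = Γ₁ ++ Θ ∧ ∀ x ∈ X.word ++ ctxWord Θ, s x ∈ X.word ++ ctxWord Θ := by
  obtain ⟨o1, o2, o3, o4, oE, oΓ, -⟩ := h.order
  have hE : (DTp.ldiv X B).WellFormed lab dep 1 := h.ctx_wf _ (by simp)
  have M := h.matching
  have Gwf : ∀ A ∈ Γ, A.WellFormed lab dep 1 := fun A hA => h.ctx_wf A (by simp [hA])
  have d0 : dep y₀ = 0 := h.goal_wf.2
  have hXE : ∀ z ∈ X.word, z ∈ (DTp.ldiv X B).word := fun z hz => by simp [DTp.word, hz]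
  have hBE : ∀ z ∈ B.word, z ∈ (DTp.ldiv X B).word := fun z hz => by simp [DTp.word, hz]
  have oXB : ∀ x ∈ X.word, ∀ z ∈ B.word, pos z < pos x := fun x hx z hz => by
    rw [DTp.word, List.pairwise_append] at oE
    exact oE.2.2 x (List.mem_reverse.2 hx) z hz
  -- Only visible heads are constrained. A head of depth 1 not matched to the left must be matched
  -- to `y₀`, the only leaf of depth 0.
  let Good : DTp α → Prop := fun A => ∀ x, A.head? = some x →
    ¬ (s x ∈ ctxWord Δ ∨ s x ∈ B.word) ∧ pos (s x) < pos x
  obtain ⟨Γ₁, Θ, rfl, hΘ, hmax⟩ := exists_maximal_suffix Good Γ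
  refine ⟨Γ₁, Θ, rfl, fun x hx => ?_⟩
  rw [ctxWord_append, List.pairwise_append] at oΓ
  have o5 : ∀ u ∈ ctxWord Θ, ∀ w ∈ ctxWord Γ₁, pos u < pos w := fun u hu w hw =>
    oΓ.2.2 w hw u hu
  have memw : ∀ z, z ∈ seqWord (Γ₁ ++ Θ ++ [DTp.ldiv X B] ++ Δ) (DTp.leaf i y₀) ↔
      (z ∈ ctxWord Δ ∨ z ∈ B.word) ∨ z ∈ X.word ++ ctxWord Θ ∨ z ∈ ctxWord Γ₁ ∨ z = y₀ :=
    fun z => by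
      simp only [mem_seqWord, ctxWord_append, ctxWord_cons, ctxWord_nil, List.append_nil,
        List.mem_append, DTp.word, List.mem_reverse, List.mem_singleton]
      tauto
  have lw : ∀ u, (u ∈ ctxWord Δ ∨ u ∈ B.word) → ∀ w ∈ X.word ++ ctxWord Θ, pos u < pos w := by
    intro u hu w hw
    rcases hu with hu | hu <;> rcases List.mem_append.1 hw with hw | hw
    · exact o1 u hu w (hXE w hw)
    · exact o3 u hu w (by simp [hw])
    · exact oXB w hw u hu
    · exact o2 u (hBE u hu) w (by simp [hw])
  have wr : ∀ u ∈ X.word ++ ctxWord Θ, ∀ w ∈ ctxWord Γ₁, pos u < pos w := by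
    intro u hu w hw
    rcases List.mem_append.1 hu with hu | hu
    · exact o2 u (hXE u hu) w (by simp [hw])
    · exact o5 u hu w hw
  have lt0 : ∀ u ∈ seqWord (Γ₁ ++ Θ ++ [DTp.ldiv X B] ++ Δ) (DTp.leaf i y₀),
      pos u ≤ pos y₀ := fun u hu => by
    rcases mem_seqWord.1 hu with hu | hu
    · exact (o4 u hu).le
    · rw [List.mem_singleton.1 hu]
  have dep0 : ∀ u ∈ seqWord (Γ₁ ++ Θ ++ [DTp.ldiv X B] ++ Δ) (DTp.leaf i y₀),
      dep u = 0 → u = y₀ := fun u hu hd => by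
    rcases mem_seqWord.1 hu with hu | hu
    · obtain ⟨A, hA, huA⟩ := mem_ctxWord.1 hu
      have := (h.ctx_wf A hA).le_dep huA
      omega
    · exact List.mem_singleton.1 hu
  have hxl := (memw x).2 (Or.inr (Or.inl hx))
  have hsxl := M.closed x hxl
  by_contra hsx
  have dx : 1 ≤ dep x := by
    rcases List.mem_append.1 hx with hx | hx
    · exact (hE.1.le_dep hx).trans' (by omega)
    · obtain ⟨A, hA, hxA⟩ := mem_ctxWord.1 hx
      exact (Gwf A (by simp [hA])).le_dep hxA
  -- A link from `x` to the right would reach `Γ₁` or `y₀`; maximality of `Θ` rules this out.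
  have hleft : s x ∈ ctxWord Δ ∨ s x ∈ B.word := by
    refine ((memw _).1 hsxl).resolve_right fun hr => ?_
    have hr := hr.resolve_left hsx
    rcases hmax with rfl | ⟨Γ₂, A, rfl, hA⟩
    · have e : s x = y₀ := by simpa using hr
      have hlt : pos x < pos (s x) := by
        have := lt0 x hxl
        have := M.pos_ne x hxl
        rw [e] at *
        omega
      have d1 := M.depth_eq x hxl hlt
      rw [e, d0] at d1
      rcases List.mem_append.1 hx with hx | hx
      · have : 1 + 1 ≤ dep x := hE.1.le_dep hx
        omega
      · obtain ⟨A, hA, hxA⟩ := mem_ctxWord.1 hx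
        have := (hΘ A hA x ((Gwf A (by simp [hA])).head?_of_dep hxA d1)).2
        omega
    · have hA' : ∃ z, A.head? = some z ∧
          ((s z ∈ ctxWord Δ ∨ s z ∈ B.word) ∨ pos z ≤ pos (s z)) := by
        simp only [Good, not_forall] at hA
        obtain ⟨z, hz, hz'⟩ := hA
        refine ⟨z, hz, ?_⟩
        by_contra hcon
        exact hz' ⟨fun h' => hcon (Or.inl h'), by
          by_contra h'
          exact hcon (Or.inr (by omega))⟩
      obtain ⟨z, hz, hbad⟩ := hA'
      have hzA := DTp.head?_mem hz
      have hzΓ : z ∈ ctxWord (Γ₂ ++ [A]) := by simp [hzA]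
      have hzl := (memw z).2 (Or.inr (Or.inr (Or.inl hzΓ)))
      have hxz := wr x hx z hzΓ
      have hAwf : A.WellFormed lab dep 1 := Gwf A (by simp)
      have dz := hAwf.dep_head hz
      have hszne := M.pos_ne z hzl
      -- The reversed order makes the head `z` of the last member of `Γ₁` the first leaf after `Θ`,
      -- so the link from `x` ends at `z` or encloses it.
      have hge : pos z ≤ pos (s x) := by
        rcases hr with hr | hr
        · simp only [ctxWord_append, ctxWord_cons, ctxWord_nil, List.append_nil,
            List.mem_append] at hr
          rcases hr with hr | hr
          · have o6 := oΓ.1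
            simp only [ctxWord_append, ctxWord_cons, ctxWord_nil, List.append_nil,
              List.pairwise_append] at o6
            exact (o6.2.2 _ hr z hzA).le
          · have o6 := oΓ.1
            simp only [ctxWord_append, ctxWord_cons, ctxWord_nil, List.append_nil,
              List.pairwise_append] at o6
            rcases DTp.head?_or_mem_args hr with hh | ⟨Y, hY, hrY⟩
            · rw [hz] at hh
              rw [Option.some.inj hh]
            · exact (DTp.head_lt_of_mem_args o6.2.1 hY hz hrY).le
        · rw [hr]
          exact lt0 z hzl
      rcases hge.lt_or_eq with hlt | heq
      · have hn := M.noncrossing x hxl z hzl hxz hlt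
        rcases hbad with hb | hb
        · have := lw _ hb x hx
          omega
        · have d1 := M.depth_eq z hzl (by omega)
          have e := dep0 _ (M.closed z hzl) (by omega)
          have := lt0 _ hsxl
          rw [e] at hn
          omega
      · have e := h.pos_injOn z hzl _ hsxl heq
        rw [e, M.invol x hxl] at hbad
        rcases hbad with hb | hb
        · exact lt_irrefl _ (lw _ hb x hx)
        · omega
  have hsE : s x ∈ ctxWord Δ ∨ s x ∈ (DTp.ldiv X B).word := hleft.imp id (hBE _)
  have hlt := lw _ hleft x hx
  have dsx := M.depth_eq' hxl hlt
  -- A link to the left raises the depth, so `s x` has depth at least 2 and is neither in `Δ` nor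
  -- the head of `B`.
  obtain ⟨Y, hY, hsY⟩ := (h.args_facts hΔ hsE).1 (by omega)
  have hsB : s x ∈ B.word := hleft.resolve_left fun hd => by
    have := hΔ _ hd
    omega
  have hYB : Y ∈ B.args := by
    rcases List.mem_cons.1 hY with rfl | hY
    · exact absurd (oXB _ hsY _ hsB) (lt_irrefl _)
    · exact hY
  have hYwf := hE.of_mem_args hY
  obtain ⟨y, hy⟩ := hYwf.exists_head (by decide)
  have hyY := DTp.head?_mem hy
  have hyB := DTp.word_subset_of_mem_args hYB hyY
  have hyl := (memw y).2 (Or.inl (Or.inr hyB))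
  have dy : dep y = 2 := hYwf.dep_head hy
  rcases (M.pos_ne y hyl).lt_or_gt with hsy | hsy
  · have := h.arg_closed hΔ hY hy hsy hsY
    rw [M.invol x hxl] at this
    exact lt_irrefl _ (lw x (Or.inr (DTp.word_subset_of_mem_args hYB this)) x hx)
  · have d1 := M.depth_eq y hyl hsy
    have hsyl := M.closed y hyl
    -- The partner of `y` has depth 1. Leaves of that depth in `Δ` or `E` precede `Y`, and in `Θ`
    -- they are heads, which `Good` forbids to be matched into `B`.
    have hsyR : s y ∈ ctxWord Γ₁ := by
      rcases (memw _).1 hsyl with hc | hc | hc | hc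
      · have := (h.args_facts hΔ (hc.imp id (hBE _))).2 (by omega) Y hY y hyY
        omega
      · exfalso
        rcases List.mem_append.1 hc with hc | hc
        · have : 1 + 1 ≤ dep (s y) := hE.1.le_dep hc
          omega
        · obtain ⟨A, hA, hyA⟩ := mem_ctxWord.1 hc
          have := (hΘ A hA _ ((Gwf A (by simp [hA])).head?_of_dep hyA (by omega))).1
          rw [M.invol y hyl] at this
          exact this (Or.inr hyB)
      · exact hc
      · rw [hc] at d1
        omega
    have hxy := wr x hx _ hsyR
    have hle := DTp.le_head (DTp.pairwise_of_mem_args oE hY) hy hsY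
    rcases hle.lt_or_eq with hlt' | heq
    · have := M.noncrossing (s x) hsxl y hyl hlt' (by
        rw [M.invol x hxl]
        exact lw y (Or.inr hyB) x hx)
      rw [M.invol x hxl] at this
      omega
    · have e := h.pos_injOn _ hsxl _ hyl heq
      rw [← e, M.invol x hxl] at hxy
      omega

end Split

/-! ### The two premises of the left rule -/

theorem IsNet.right_premise {Γ Θ Δ : List (DTp α)} {X B D : DTp α}
    (h : IsNet s lab pos dep (Γ ++ Θ ++ [DTp.ldiv X B] ++ Δ) D)
    (hc : ∀ x ∈ X.word ++ ctxWord Θ, s x ∈ X.word ++ ctxWord Θ) :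
    IsNet s lab pos dep (Γ ++ [B] ++ Δ) D := by
  have hs := h.sorted
  have hw := h.ctx_wf
  have hh := h.ctx_head
  have hB : (DTp.ldiv X B).WellFormed lab dep 1 := hw _ (by simp)
  have hB' : (DTp.ldiv X B).ArgsHeadCond s pos := hh _ (by simp)
  have sub : ∀ x, x ∈ seqWord (Γ ++ Θ ++ [DTp.ldiv X B] ++ Δ) D ↔
      x ∈ X.word ++ ctxWord Θ ∨ x ∈ seqWord (Γ ++ [B] ++ Δ) D := fun x => by
    simp only [mem_seqWord, ctxWord_append, ctxWord_cons, ctxWord_nil, List.append_nil,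
      List.mem_append, DTp.word, List.mem_reverse]
    tauto
  have disj : ∀ x ∈ seqWord (Γ ++ [B] ++ Δ) D, x ∉ X.word ++ ctxWord Θ := by
    have hn : (seqWord (Γ ++ Θ ++ [DTp.ldiv X B] ++ Δ) D).Nodup :=
      hs.imp fun {a b} hab e => by
        rw [e] at hab
        exact lt_irrefl _ hab
    intro x hx hx'
    simp only [seqWord, ctxWord_append, ctxWord_cons, ctxWord_nil,
      List.append_nil, List.mem_append, DTp.word, List.mem_reverse, List.nodup_append,
      List.nodup_reverse] at hx hx' hn
    grind
  refine ⟨hs.sublist ?_, h.matching.restrict (fun x hx => (sub x).2 (Or.inr hx)) ?_, ?_,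
    h.goal_wf, ?_, h.goal_head⟩
  · refine List.Sublist.append (List.Sublist.reverse ?_) (List.Sublist.refl _)
    simp only [ctxWord_append, ctxWord_cons, ctxWord_nil, List.append_nil, DTp.word,
      List.append_assoc]
    refine List.Sublist.append (List.Sublist.refl _) ?_
    exact (List.sublist_append_right _ _).trans (List.sublist_append_right _ _)
  · intro x hx
    have hxl := (sub x).2 (Or.inr hx)
    refine ((sub _).1 (h.matching.closed x hxl)).resolve_left fun hsx => disj x hx ?_
    have := hc _ hsx
    rwa [h.matching.invol x hxl] at this
  · intro A hA
    simp only [List.mem_append, List.mem_singleton] at hA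
    rcases hA with (hA | rfl) | hA
    · exact hw A (by simp [hA])
    · exact hB.2
    · exact hw A (by simp [hA])
  · intro A hA
    simp only [List.mem_append, List.mem_singleton] at hA
    rcases hA with (hA | rfl) | hA
    · exact hh A (by simp [hA])
    · exact hB'.2.2
    · exact hh A (by simp [hA])

theorem exists_pos_bound (pos : α → ℕ) (l : List α) : ∃ N, ∀ x ∈ l, pos x < N := by
  induction l with
  | nil => exact ⟨0, by simp⟩
  | cons a l ih =>
    obtain ⟨N, hN⟩ := ih
    refine ⟨N + pos a + 1, fun x hx => ?_⟩
    rcases List.mem_cons.1 hx with rfl | hx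
    · omega
    · have := hN x hx
      omega

-- In the old order `X` precedes `Θ`, while the sequent `Θ → X` puts `X` last with root depth 0
-- instead of 2. Links between the two parts reverse direction, and the depth shift by two restores
-- the depth rule.
open Classical in
theorem IsNet.left_premise {Γ Θ Δ : List (DTp α)} {X B D : DTp α}
    (h : IsNet s lab pos dep (Γ ++ Θ ++ [DTp.ldiv X B] ++ Δ) D)
    (hc : ∀ x ∈ X.word ++ ctxWord Θ, s x ∈ X.word ++ ctxWord Θ) :
    ∃ pos' dep', IsNet s lab pos' dep' Θ X := by
  obtain ⟨N, hN⟩ := exists_pos_bound pos (ctxWord Θ)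
  have hs := h.sorted
  have hw := h.ctx_wf
  have hh := h.ctx_head
  have hE : (DTp.ldiv X B).WellFormed lab dep 1 := hw _ (by simp)
  have hE' : (DTp.ldiv X B).ArgsHeadCond s pos := hh _ (by simp)
  simp only [seqWord, ctxWord_append, ctxWord_cons, ctxWord_nil, List.append_nil, DTp.word,
    List.pairwise_append, List.pairwise_reverse, List.mem_reverse, List.mem_append] at hs
  have sX : X.word.Pairwise (pos · < pos ·) := hs.1.1.2.1.1
  have sΘ : (ctxWord Θ).Pairwise (pos · > pos ·) := hs.1.1.1.2.1
  have huv : ∀ x ∈ X.word, ∀ y ∈ ctxWord Θ, pos x < pos y := fun x hx y hy =>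
    hs.1.1.2.2 y (Or.inr hy) x (Or.inl hx)
  have sub : ∀ x ∈ X.word ++ ctxWord Θ,
      x ∈ seqWord (Γ ++ Θ ++ [DTp.ldiv X B] ++ Δ) D := fun x hx => by
    simp only [mem_seqWord, ctxWord_append, ctxWord_cons, ctxWord_nil, List.append_nil,
      List.mem_append, DTp.word, List.mem_reverse] at hx ⊢
    tauto
  have notX : ∀ y ∈ ctxWord Θ, y ∉ X.word := fun y hy hy' => lt_irrefl _ (huv y hy' y hy)
  -- `N` bounds the positions in `Θ`, so adding it moves `X` behind `Θ`. The subtraction is never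
  -- truncated on `X`, where depths are at least 2.
  let pos' : α → ℕ := fun x => if x ∈ X.word then pos x + N else pos x
  let dep' : α → ℕ := fun x => if x ∈ X.word then dep x - 2 else dep x
  have hu : ∀ x ∈ X.word, pos' x = pos x + N ∧ dep' x + 2 = dep x := fun x hx => by
    have : 1 + 1 ≤ dep x := hE.1.le_dep hx
    simp only [pos', dep', if_pos hx, true_and]
    omega
  have hv : ∀ x ∈ ctxWord Θ, pos' x = pos x ∧ dep' x = dep x := fun x hx => by
    simp only [pos', dep', if_neg (notX x hx), and_self]
  have M := h.matching.restrict sub hc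
  have M' := M.rotate huv hN
    (fun x hx y hy => h.pos_injOn x (sub x hx) y (sub y hy)) hu hv
  refine ⟨pos', dep', ?_, ?_, ?_, hE.1.shift fun x hx => (hu x hx).2, ?_, ?_⟩
  · rw [seqWord, List.pairwise_append, List.pairwise_reverse]
    refine ⟨sΘ.imp_of_mem fun {a b} ha hb hab => ?_, sX.imp_of_mem fun {a b} ha hb hab => ?_,
      fun a ha b hb => ?_⟩
    · rw [(hv a ha).1, (hv b hb).1]
      exact hab
    · rw [(hu a ha).1, (hu b hb).1]
      omega
    · have ha := List.mem_reverse.1 ha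
      rw [(hv a ha).1, (hu b hb).1]
      have := hN a ha
      omega
  · refine M'.restrict (fun x hx => ?_) fun x hx => ?_
    · rwa [List.mem_append, ← mem_seqWord]
    · rw [mem_seqWord, ← List.mem_append] at hx ⊢
      exact M'.closed x hx
  · exact fun A hA => (hw A (by simp [hA])).congr fun x hx =>
      (hv x (mem_ctxWord.2 ⟨A, hA, hx⟩)).2
  · intro A hA
    have inΘ : ∀ x ∈ A.word, x ∈ ctxWord Θ := fun x hx => mem_ctxWord.2 ⟨A, hA, hx⟩
    refine (hh A (by simp [hA])).mono fun a ha x hx h1 h2 => ?_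
    have e1 := (hv a (inΘ a ha)).1
    have e2 := (hv x (inΘ x hx)).1
    have b := hN x (inΘ x hx)
    -- If the partner of `x` is in the other part, its new position is not between `a` and `x`, so
    -- the premise fails; the same happens for `X` below.
    rcases List.mem_append.1 (hc x (List.mem_append_right _ (inΘ x hx))) with hsx | hsx
    · have := (hu _ hsx).1
      omega
    · have := (hv _ hsx).1
      omega
  · refine hE'.2.1.mono fun a ha x hx h1 h2 => ?_
    have e1 := (hu a ha).1
    have e2 := (hu x hx).1
    rcases List.mem_append.1 (hc x (List.mem_append_left _ hx)) with hsx | hsx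
    · have := (hu _ hsx).1
      omega
    · have := (hv _ hsx).1
      have := hN _ hsx
      omega

/-! ### Choice of the division and construction of the derivation -/

/-- A net all of whose antecedent members are leaves or divisions has a single leaf as
antecedent, or has a division preceded, in the order of its leaves, by leaves of depth one only. -/
theorem IsNet.eq_singleton_or_ldiv {Φ : List (DTp α)} {i : ℕ} {y : α}
    (h : IsNet s lab pos dep Φ (DTp.leaf i y))
    (hbang : ∀ A, DTp.bang A ∉ Φ) (hweak : ∀ A, DTp.weak A ∉ Φ) :
    (∃ x, Φ = [DTp.leaf i x]) ∨
      ∃ Γ X B Δ, Φ = Γ ++ [DTp.ldiv X B] ++ Δ ∧ ∀ z ∈ ctxWord Δ, dep z = 1 := by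
  have M := h.matching
  have d0 : dep y = 0 := h.goal_wf.2
  have hyl : y ∈ seqWord Φ (DTp.leaf i y) := by simp [mem_seqWord, DTp.word]
  rcases List.eq_nil_or_concat Φ with rfl | ⟨Φ, A, rfl⟩
  · have := M.closed y hyl
    have e : s y = y := by simpa [mem_seqWord, DTp.word] using this
    exact absurd (congrArg pos e) (M.pos_ne y hyl)
  rw [List.concat_eq_append] at *
  cases A with
  | bang A => exact absurd (by simp) (hbang A)
  | weak A => exact absurd (by simp) (hweak A)
  | ldiv X B => exact Or.inr ⟨Φ, X, B, [], by simp, by simp⟩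
  | leaf j x =>
    have hx : (DTp.leaf j x).WellFormed lab dep 1 := h.ctx_wf _ (by simp)
    have dx : dep x = 1 := hx.2
    have hs := h.sorted
    have hxl : x ∈ seqWord (Φ ++ [DTp.leaf j x]) (DTp.leaf i y) := by
      simp [mem_seqWord, DTp.word]
    have ltx : ∀ z ∈ seqWord (Φ ++ [DTp.leaf j x]) (DTp.leaf i y), z = x ∨ pos x < pos z := by
      intro z hz
      simp only [seqWord, ctxWord_append, ctxWord_cons, ctxWord_nil, List.append_nil, DTp.word,
        List.pairwise_append, List.pairwise_reverse, List.mem_reverse, List.mem_append,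
        List.mem_singleton, List.reverse_append, List.reverse_singleton] at hs hz
      grind
    have dep0 : ∀ u ∈ seqWord (Φ ++ [DTp.leaf j x]) (DTp.leaf i y), dep u = 0 → u = y :=
      fun u hu hd => by
        rcases mem_seqWord.1 hu with hu | hu
        · obtain ⟨A, hA, huA⟩ := mem_ctxWord.1 hu
          have := (h.ctx_wf A hA).le_dep huA
          omega
        · exact List.mem_singleton.1 hu
    -- `x` is the least leaf, so it is matched to the right, with depth 0.
    have hxs : s x = y := by
      have hlt := (ltx _ (M.closed x hxl)).resolve_left fun e =>
        M.pos_ne x hxl (congrArg pos e)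
      have := M.depth_eq x hxl hlt
      exact dep0 _ (M.closed x hxl) (by omega)
    rcases List.eq_nil_or_concat Φ with rfl | ⟨Φ, A, rfl⟩
    · have h1 := M.lab_eq x hxl
      have h2 : lab y = some i := h.goal_wf.1
      rw [hxs, hx.1, h2] at h1
      obtain rfl := Option.some.inj h1
      exact Or.inl ⟨x, rfl⟩
    · rw [List.concat_eq_append] at *
      cases A with
      | bang A => exact absurd (by simp) (hbang A)
      | weak A => exact absurd (by simp) (hweak A)
      | ldiv X B => exact Or.inr ⟨Φ, X, B, [DTp.leaf j x], by simp, by simpa [DTp.word]⟩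
      | leaf k z =>
        exfalso
        have hz : (DTp.leaf k z).WellFormed lab dep 1 := h.ctx_wf _ (by simp)
        have dz : dep z = 1 := hz.2
        have hzl : z ∈ seqWord (Φ ++ [DTp.leaf k z] ++ [DTp.leaf j x]) (DTp.leaf i y) := by
          simp [mem_seqWord, DTp.word]
        have hltz : ∀ u ∈ seqWord (Φ ++ [DTp.leaf k z] ++ [DTp.leaf j x]) (DTp.leaf i y),
            pos u < pos z → u = x := by
          intro u hu
          simp only [seqWord, ctxWord_append, ctxWord_cons, ctxWord_nil, List.append_nil,
            DTp.word, List.pairwise_append, List.pairwise_reverse, List.mem_reverse,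
            List.mem_append, List.mem_singleton, List.reverse_append,
            List.reverse_singleton] at hs hu
          grind
        have hxz : pos x < pos z := by
          simp only [seqWord, ctxWord_append, ctxWord_cons, ctxWord_nil, List.append_nil,
            DTp.word, List.pairwise_append, List.pairwise_reverse, List.mem_reverse,
            List.mem_append, List.mem_singleton, List.reverse_append,
            List.reverse_singleton] at hs
          grind
        -- A second leaf `z` of depth 1 has nowhere to go: to its left is only `x`, of the wrong
        -- depth, and to its right it needs `y`, already taken by `x`.
        rcases (M.pos_ne z hzl).lt_or_gt with hlt | hlt
        · have d1 := M.depth_eq' hzl hlt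
          rw [hltz _ (M.closed z hzl) hlt] at d1
          omega
        · have d1 := M.depth_eq z hzl hlt
          have e := dep0 _ (M.closed z hzl) (by omega)
          have e1 := M.invol z hzl
          rw [e, ← hxs, M.invol x hxl] at e1
          rw [e1] at hxz
          omega

/-- The number of connectives and leaves of an antecedent. -/
def ctxSize (Φ : List (DTp α)) : ℕ := (Φ.map DTp.size).sum

theorem IsNet.derivable {Φ : List (DTp α)} {D : DTp α} (h : IsNet s lab pos dep Φ D) :
    Derivable (Φ.map DTp.erase) D.erase := by
  -- Order and depth must vary in the induction because of the left premise; the matching and the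
  -- labels stay fixed.
  induction hn : ctxSize Φ + D.size using Nat.strong_induction_on generalizing pos dep Φ D with
  | _ n ih =>
  subst hn
  cases D with
  | bang A => exact absurd h.goal_wf.1 (by decide)
  | weak A => exact absurd h.goal_wf (by decide : ¬ Odd 0)
  | ldiv A B =>
    refine Derivable.ldivRight (ih _ ?_ h.of_ldiv rfl)
    simp only [ctxSize, DTp.size, List.map_cons, List.sum_cons]
    omega
  | leaf i y =>
    by_cases hb : ∃ A, DTp.bang A ∈ Φ
    · obtain ⟨A, hA⟩ := hb
      obtain ⟨Γ, Δ, rfl⟩ := List.append_of_mem hA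
      have e : Γ ++ DTp.bang A :: Δ = Γ ++ [DTp.bang A] ++ Δ := by simp
      rw [e] at h ih ⊢
      have h' := h.of_bang
      have := ih _ (by simp [ctxSize, DTp.size]) h' rfl
      simp only [List.map_append, List.map_cons, List.map_nil] at this ⊢
      exact Derivable.bangLeft this
    by_cases hw : ∃ A, DTp.weak A ∈ Φ
    · obtain ⟨A, hA⟩ := hw
      obtain ⟨Γ, Δ, rfl⟩ := List.append_of_mem hA
      have e : Γ ++ DTp.weak A :: Δ = Γ ++ [DTp.weak A] ++ Δ := by simp
      rw [e] at h ih ⊢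
      have h' := h.of_weak
      have := ih _ (by simp [ctxSize, DTp.size]) h' rfl
      simp only [List.map_append, List.map_cons, List.map_nil] at this ⊢
      exact Derivable.weakening this
    rcases h.eq_singleton_or_ldiv (not_exists.1 hb) (not_exists.1 hw) with
      ⟨x, rfl⟩ | ⟨Γ, X, B, Δ, rfl, hΔ⟩
    · exact Derivable.ax i
    · obtain ⟨Γ, Θ, rfl, hc⟩ := h.exists_split hΔ
      obtain ⟨pos', dep', hl⟩ := h.left_premise hc
      have h1 := ih _ (by simp [ctxSize, DTp.size]; omega) hl rfl
      have h2 := ih _ (by simp [ctxSize, DTp.size]; omega) (h.right_premise hc) rfl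
      simp only [List.map_append, List.map_cons, List.map_nil] at h1 h2 ⊢
      exact Derivable.ldivLeft h1 h2

/-! ### Trees of types and their full subtrees -/

open Vertex

namespace Vertex

theorem arc_unique {A : Tp} {a b c : Vertex A} {ℓ ℓ' : ArcLabel} (h : Arc a ℓ b)
    (h' : Arc a ℓ' c) : ℓ = ℓ' ∧ b = c := by
  induction h with
  | bangRoot A => cases h' with
    | bangRoot => exact ⟨rfl, rfl⟩
    | inBang h' => cases h'
  | leftRoot A B => cases h' with
    | leftRoot => exact ⟨rfl, rfl⟩
    | inLeft h' => cases h'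
  | rightRoot A B => cases h' with
    | rightRoot => exact ⟨rfl, rfl⟩
    | inRight h' => cases h'
  | inBang h ih => cases h' with
    | bangRoot => cases h
    | inBang h' => exact ⟨(ih h').1, congrArg _ (ih h').2⟩
  | inLeft h ih => cases h' with
    | leftRoot => cases h
    | inLeft h' => exact ⟨(ih h').1, congrArg _ (ih h').2⟩
  | inRight h ih => cases h' with
    | rightRoot => cases h
    | inRight h' => exact ⟨(ih h').1, congrArg _ (ih h').2⟩

theorem Below.map {A B : Tp} {f : Vertex A → Vertex B}
    (hf : ∀ a ℓ b, Arc a ℓ b → Arc (f a) ℓ (f b)) {a b : Vertex A} (h : Below a b) :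
    Below (f a) (f b) := by
  induction h with
  | refl => exact Relation.ReflTransGen.refl
  | tail _ hstep ih =>
    obtain ⟨ℓ, harc⟩ := hstep
    exact ih.tail ⟨ℓ, hf _ _ _ harc⟩

theorem below_root {A : Tp} (a : Vertex A) : Below a (root A) := by
  induction a with
  | root A => exact Relation.ReflTransGen.refl
  | inBang a ih =>
    exact (Below.map (fun _ _ _ => Arc.inBang) ih).tail ⟨_, Arc.bangRoot _⟩
  | inLeft a ih =>
    exact (Below.map (fun _ _ _ => Arc.inLeft) ih).tail ⟨_, Arc.leftRoot _ _⟩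
  | inRight a ih =>
    exact (Below.map (fun _ _ _ => Arc.inRight) ih).tail ⟨_, Arc.rightRoot _ _⟩

theorem lt_asymm {A : Tp} {a b : Vertex A} (h : Lt a b) : ¬ Lt b a := by
  induction a with
  | root A => cases b <;> cases A <;> simp_all [Lt]
  | inBang a ih => cases b <;> simp_all [Lt]
  | inLeft a ih =>
    cases b with
    | inLeft b => exact fun h' => ih h' h
    | root => simp [Lt]
    | inRight b => simp [Lt]
  | inRight a ih => cases b <;> simp_all [Lt]

/-- If `c` and `r` have the same head and no arc labelled `1` or `2` leaves `r`, then a path leads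
from `c` to `r`. -/
theorem below_of_isHead {A : Tp} {x c r : Vertex A} (hc : IsHead x c) (hr : IsHead x r)
    (htop : ∀ ℓ b, Arc r ℓ b → ℓ = ArcLabel.neg) : Below c r := by
  obtain ⟨-, hc⟩ := hc
  obtain ⟨-, hr⟩ := hr
  have mono : ∀ {u v : Vertex A}, Relation.ReflTransGen
      (fun x y => ∃ ℓ, ℓ ≠ ArcLabel.neg ∧ Arc x ℓ y) u v → Below u v := fun h => by
    induction h with
    | refl => exact Relation.ReflTransGen.refl
    | tail _ hstep ih =>
      obtain ⟨ℓ, _, harc⟩ := hstep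
      exact ih.tail ⟨ℓ, harc⟩
  induction hc using Relation.ReflTransGen.head_induction_on with
  | refl => exact mono hr
  | head hstep _ ih =>
    obtain ⟨ℓ, hℓ, harc⟩ := hstep
    rcases hr.cases_head with rfl | ⟨z, ⟨ℓ', _, harc'⟩, hr⟩
    · exact absurd (htop _ _ harc) hℓ
    · obtain ⟨-, rfl⟩ := arc_unique harc harc'
      exact ih hr

end Vertex

/-- `f` embeds the tree of `A` as a full subtree of the tree of `T`. -/
structure IsSubtree {A T : Tp} (f : Vertex A → Vertex T) : Prop where
  arc : ∀ a ℓ b, Arc a ℓ b → Arc (f a) ℓ (f b)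
  down : ∀ v ℓ w, Arc v ℓ (f w) → ∃ u, v = f u ∧ Arc u ℓ w
  label : ∀ a, Vertex.label (f a) = Vertex.label a

namespace IsSubtree

variable {T : Tp}

theorem id : IsSubtree (fun v : Vertex T => v) :=
  ⟨fun _ _ _ h => h, fun v _ _ h => ⟨v, rfl, h⟩, fun _ => rfl⟩

theorem inBang {A : Tp} {f : Vertex (Tp.bang A) → Vertex T} (h : IsSubtree f) :
    IsSubtree (fun v => f (Vertex.inBang v)) where
  arc _ _ _ h' := h.arc _ _ _ (Arc.inBang h')
  down v ℓ w h' := by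
    obtain ⟨u, rfl, hu⟩ := h.down v ℓ _ h'
    cases hu with
    | inBang hu => exact ⟨_, rfl, hu⟩
  label a := h.label _

theorem inLeft {A B : Tp} {f : Vertex (Tp.ldiv A B) → Vertex T} (h : IsSubtree f) :
    IsSubtree (fun v => f (Vertex.inLeft v)) where
  arc _ _ _ h' := h.arc _ _ _ (Arc.inLeft h')
  down v ℓ w h' := by
    obtain ⟨u, rfl, hu⟩ := h.down v ℓ _ h'
    cases hu with
    | inLeft hu => exact ⟨_, rfl, hu⟩
  label a := h.label _

theorem inRight {A B : Tp} {f : Vertex (Tp.ldiv A B) → Vertex T} (h : IsSubtree f) :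
    IsSubtree (fun v => f (Vertex.inRight v)) where
  arc _ _ _ h' := h.arc _ _ _ (Arc.inRight h')
  down v ℓ w h' := by
    obtain ⟨u, rfl, hu⟩ := h.down v ℓ _ h'
    cases hu with
    | inRight hu => exact ⟨_, rfl, hu⟩
  label a := h.label _

variable {A : Tp} {f : Vertex A → Vertex T}

theorem isLeaf_iff (h : IsSubtree f) (a : Vertex A) : IsLeaf (f a) ↔ IsLeaf a := by
  rw [isLeaf_iff_label, isLeaf_iff_label, h.label]

theorem below (h : IsSubtree f) (a : Vertex A) : Below (f a) (f (root A)) :=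
  Below.map h.arc (below_root a)

theorem exists_of_below (h : IsSubtree f) {v : Vertex T} {w : Vertex A} (hv : Below v (f w)) :
    ∃ u, v = f u := by
  induction hv using Relation.ReflTransGen.head_induction_on with
  | refl => exact ⟨w, rfl⟩
  | head hstep _ ih =>
    obtain ⟨u, rfl⟩ := ih
    obtain ⟨ℓ, harc⟩ := hstep
    obtain ⟨u', rfl, -⟩ := h.down _ _ _ harc
    exact ⟨u', rfl⟩

end IsSubtree

/-! ### From a proof net to a matching -/

open Classical in
/-- Name the leaves of `A` by their images under `f`, dropping everything outside `U`. -/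
noncomputable def decorate {T : Tp} (U : Set (Vertex T)) :
    (A : Tp) → (Vertex A → Vertex T) → DTp (Vertex T)
  | Tp.prim i, f => DTp.leaf i (f (root _))
  | Tp.bang A, f =>
    if f (inBang (root A)) ∈ U then DTp.bang (decorate U A fun v => f (inBang v)) else DTp.weak A
  | Tp.ldiv A B, f =>
    DTp.ldiv (decorate U A fun v => f (inLeft v)) (decorate U B fun v => f (inRight v))

section Decorate

variable {T : Tp} {U : Set (Vertex T)}

theorem erase_decorate (A : Tp) (f : Vertex A → Vertex T) : (decorate U A f).erase = A := by
  induction A with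
  | prim i => rfl
  | bang A ih =>
    rw [decorate]
    split_ifs
    · rw [DTp.erase, ih]
    · rfl
  | ldiv A B ihA ihB => rw [decorate, DTp.erase, ihA, ihB]

theorem exists_of_mem_decorate {A : Tp} {f : Vertex A → Vertex T} {x : Vertex T}
    (hx : x ∈ (decorate U A f).word) : ∃ a, x = f a := by
  induction A with
  | prim i => exact ⟨_, List.mem_singleton.1 hx⟩
  | bang A ih =>
    rw [decorate] at hx
    split_ifs at hx
    · obtain ⟨a, rfl⟩ := ih hx
      exact ⟨_, rfl⟩
    · simp [DTp.word] at hx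
  | ldiv A B ihA ihB =>
    rcases List.mem_append.1 hx with hx | hx
    · obtain ⟨a, rfl⟩ := ihA (List.mem_reverse.1 hx)
      exact ⟨_, rfl⟩
    · obtain ⟨a, rfl⟩ := ihB hx
      exact ⟨_, rfl⟩

theorem pairwise_decorate {A : Tp} {f : Vertex A → Vertex T} {R : Vertex T → Vertex T → Prop}
    (hR : ∀ a b, Lt a b → R (f a) (f b)) : (decorate U A f).word.Pairwise R := by
  induction A generalizing R with
  | prim i => exact List.pairwise_singleton _ _
  | bang A ih =>
    rw [decorate]
    split_ifs
    · exact ih fun a b h => hR _ _ h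
    · exact List.Pairwise.nil
  | ldiv A B ihA ihB =>
    rw [decorate, DTp.word, List.pairwise_append, List.pairwise_reverse]
    refine ⟨ihA fun a b h => hR _ _ h, ihB fun a b h => hR _ _ h, fun x hx y hy => ?_⟩
    obtain ⟨a, rfl⟩ := exists_of_mem_decorate (List.mem_reverse.1 hx)
    obtain ⟨b, rfl⟩ := exists_of_mem_decorate hy
    exact hR _ _ trivial

theorem isHead_decorate {A : Tp} {f : Vertex A → Vertex T} (hf : IsSubtree f) {x : Vertex T}
    (hx : (decorate U A f).head? = some x) : IsHead x (f (root A)) := by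
  induction A with
  | prim i =>
    obtain rfl := Option.some.inj hx
    refine ⟨?_, Relation.ReflTransGen.refl⟩
    rw [hf.isLeaf_iff, isLeaf_iff_label]
    exact ⟨i, rfl⟩
  | bang A ih =>
    rw [decorate] at hx
    split_ifs at hx
    · obtain ⟨h1, h2⟩ := ih hf.inBang hx
      exact ⟨h1, h2.tail ⟨_, by simp, hf.arc _ _ _ (Arc.bangRoot A)⟩⟩
    · simp [DTp.head?] at hx
  | ldiv A B ihA ihB =>
    obtain ⟨h1, h2⟩ := ihB hf.inRight hx
    exact ⟨h1, h2.tail ⟨_, by simp, hf.arc _ _ _ (Arc.rightRoot A B)⟩⟩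

end Decorate

namespace TypeNet

variable {T : Tp} (N : TypeNet T)

theorem mem_U_of_arc {a b : Vertex T} {ℓ : ArcLabel} (h : Arc a ℓ b) (hℓ : ℓ ≠ ArcLabel.two)
    (hb : b ∈ N.U) : a ∈ N.U := by
  by_contra ha
  exact N.down_closed a b ℓ h ha hℓ hb

theorem mem_U_of_below {a b : Vertex T} (h : Below a b) (ha : a ∈ N.U) : b ∈ N.U := by
  induction h with
  | refl => exact ha
  | tail _ hstep ih =>
    obtain ⟨ℓ, harc⟩ := hstep
    by_contra hb
    exact N.up_closed _ _ _ harc hb ih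

theorem isLeaf_and_mem_U_of_mem_decorate {A : Tp} {f : Vertex A → Vertex T} (hf : IsSubtree f)
    (hr : f (root A) ∈ N.U) {x : Vertex T} (hx : x ∈ (decorate N.U A f).word) :
    IsLeaf x ∧ x ∈ N.U := by
  induction A with
  | prim i =>
    rw [List.mem_singleton.1 hx]
    refine ⟨?_, hr⟩
    rw [hf.isLeaf_iff, isLeaf_iff_label]
    exact ⟨i, rfl⟩
  | bang A ih =>
    rw [decorate] at hx
    split_ifs at hx with hU
    · exact ih hf.inBang hU hx
    · simp [DTp.word] at hx
  | ldiv A B ihA ihB =>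
    rcases List.mem_append.1 hx with hx | hx
    · exact ihA hf.inLeft (N.mem_U_of_arc (hf.arc _ _ _ (Arc.leftRoot A B)) (by simp) hr)
        (List.mem_reverse.1 hx)
    · exact ihB hf.inRight (N.mem_U_of_arc (hf.arc _ _ _ (Arc.rightRoot A B)) (by simp) hr)
        hx

/-- `U` is closed towards the root, so no `!` above a leaf in `U` has its content dropped. -/
theorem mem_decorate {A : Tp} {f : Vertex A → Vertex T} (hf : IsSubtree f) {a : Vertex A}
    (ha : IsLeaf a) (haU : f a ∈ N.U) : f a ∈ (decorate N.U A f).word := by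
  induction A with
  | prim i => cases a; exact List.mem_singleton.2 rfl
  | bang A ih =>
    cases a with
    | root => exact absurd (Arc.bangRoot A) (ha _ _)
    | inBang a =>
      have hU := N.mem_U_of_below (hf.inBang.below a) haU
      rw [decorate, if_pos hU]
      exact ih hf.inBang (fun b ℓ h => ha _ _ (Arc.inBang h)) haU
  | ldiv A B ihA ihB =>
    cases a with
    | root => exact absurd (Arc.leftRoot A B) (ha _ _)
    | inLeft a =>
      exact List.mem_append_left _ (List.mem_reverse.2
        (ihA hf.inLeft (fun b ℓ h => ha _ _ (Arc.inLeft h)) haU))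
    | inRight a =>
      exact List.mem_append_right _
        (ihB hf.inRight (fun b ℓ h => ha _ _ (Arc.inRight h)) haU)

theorem wellFormed_decorate {A : Tp} {f : Vertex A → Vertex T} (hf : IsSubtree f) :
    (decorate N.U A f).WellFormed Vertex.label Vertex.depth (depth (f (root A))) := by
  induction A with
  | prim i => exact ⟨hf.label _, rfl⟩
  | bang A ih =>
    have harc := hf.arc _ _ _ (Arc.bangRoot A)
    have hodd : Odd (depth (f (root (Tp.bang A)))) := by
      rw [← Nat.not_even_iff_odd]
      exact fun he => N.bang_odd _ _ _ harc he rfl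
    rw [decorate]
    split_ifs
    · refine ⟨hodd, ?_⟩
      rw [← (depth_of_arc harc).2 (by simp)]
      exact ih hf.inBang
    · exact hodd
  | ldiv A B ihA ihB =>
    refine ⟨?_, ?_⟩
    · rw [← (depth_of_arc (hf.arc _ _ _ (Arc.leftRoot A B))).1 rfl]
      exact ihA hf.inLeft
    · rw [← (depth_of_arc (hf.arc _ _ _ (Arc.rightRoot A B))).2 (by simp)]
      exact ihB hf.inRight

theorem argsHeadCond_decorate {s : Vertex T → Vertex T} {pos : Vertex T → ℕ} {l : List (Vertex T)}
    (hs : ∀ x ∈ l, N.S x (s x)) (hl : ∀ x ∈ l, s x ∈ l)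
    (hpos : ∀ x ∈ l, ∀ y ∈ l, pos x < pos y → Lt x y)
    {A : Tp} {f : Vertex A → Vertex T} (hf : IsSubtree f)
    (hA : ∀ x ∈ (decorate N.U A f).word, x ∈ l) :
    (decorate N.U A f).ArgsHeadCond s pos := by
  induction A with
  | prim i => trivial
  | bang A ih =>
    rw [decorate] at hA ⊢
    split_ifs at hA ⊢
    · exact ih hf.inBang hA
    · trivial
  | ldiv A B ihA ihB =>
    have hL : ∀ x ∈ (decorate N.U A fun v => f (inLeft v)).word, x ∈ l := fun x hx =>
      hA x (List.mem_append_left _ (List.mem_reverse.2 hx))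
    refine ⟨fun x hx a ha h1 h2 => ?_, ihA hf.inLeft hL,
      ihB hf.inRight fun x hx => hA x (List.mem_append_right _ hx)⟩
    have hxl := hL x (DTp.head?_mem hx)
    have hal := hL a ha
    obtain ⟨b, rfl⟩ := exists_of_mem_decorate ha
    have hhead := isHead_decorate hf.inLeft hx
    obtain ⟨d, hd1, hd2⟩ := N.head _ _ _ _ _ (hf.inLeft.below b) hhead (hs _ hal) (hs _ hxl)
      (hpos _ hal _ (hl _ hxl) h1) (hpos _ (hl _ hxl) _ hxl h2)
    -- The arc leaving the root of a left argument has label -1, so the vertex `d` supplied by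
    -- `N.head` cannot lie above that root. Hence `s a` lies in the argument.
    have hdr := below_of_isHead hd2 hhead fun ℓ c hc =>
      (arc_unique hc (hf.arc _ _ _ (Arc.leftRoot A B))).1
    obtain ⟨u, hu⟩ := hf.inLeft.exists_of_below (hd1.trans hdr)
    have hS := N.symm _ _ (hs _ hal)
    have hU := (N.domain _).1 ⟨_, hS⟩
    rw [hu] at hU ⊢
    exact N.mem_decorate hf.inLeft ((hf.inLeft.isLeaf_iff u).1 hU.1) hU.2

open Classical in
theorem exists_isNet : ∃ (s : Vertex T → Vertex T) (pos : Vertex T → ℕ),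
    IsNet s Vertex.label pos Vertex.depth [] (decorate N.U T fun v => v) := by
  have hid : IsSubtree (fun v : Vertex T => v) := IsSubtree.id
  have hroot : root T ∈ N.U := by
    obtain ⟨a, b, hab⟩ := N.nonempty
    exact N.mem_U_of_below (below_root a) ((N.domain a).1 ⟨b, hab⟩).2
  set l := (decorate N.U T fun v => v).word with hldef
  have hmem : ∀ x, x ∈ l ↔ ∃ y, N.S x y := fun x => by
    rw [N.domain]
    exact ⟨N.isLeaf_and_mem_U_of_mem_decorate hid hroot, fun h => N.mem_decorate hid h.1 h.2⟩
  have hex : ∀ x, ∃ y, x ∈ l → N.S x y := fun x => by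
    by_cases hx : x ∈ l
    · obtain ⟨y, hy⟩ := (hmem x).1 hx
      exact ⟨y, fun _ => hy⟩
    -- Outside the word the value of `s` is arbitrary.
    · exact ⟨x, fun h => absurd h hx⟩
  choose s hs using hex
  have hcl : ∀ x ∈ l, s x ∈ l := fun x hx => (hmem _).2 ⟨x, N.symm _ _ (hs x hx)⟩
  have hLt : l.Pairwise Lt := pairwise_decorate fun a b h => h
  have hidx := List.pairwise_iff_getElem.1 hLt
  have hpos : ∀ x ∈ l, ∀ y ∈ l, l.idxOf x < l.idxOf y → Lt x y := fun x hx y hy h => by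
    have := hidx _ _ (List.idxOf_lt_length_of_mem hx) (List.idxOf_lt_length_of_mem hy) h
    simpa using this
  have hinj : ∀ x ∈ l, ∀ y ∈ l, l.idxOf x = l.idxOf y → x = y := fun x hx y hy h =>
    (List.idxOf_inj hx).1 h
  have hpos' : ∀ x ∈ l, ∀ y ∈ l, Lt x y → l.idxOf x < l.idxOf y := fun x hx y hy h => by
    by_contra hcon
    rcases (not_lt.1 hcon).lt_or_eq with h' | h'
    · exact Vertex.lt_asymm h (hpos y hy x hx h')
    · rw [hinj y hy x hx h'] at h
      exact Vertex.lt_asymm h h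
  have hsw : seqWord [] (decorate N.U T fun v => v) = l := by simp [seqWord, hldef]
  refine ⟨s, fun x => l.idxOf x, ?_, ?_, by simp, N.wellFormed_decorate hid, by simp,
    N.argsHeadCond_decorate hs hcl hpos hid fun x hx => hx⟩
  · rw [hsw]
    exact hLt.imp_of_mem fun {a b} ha hb h => hpos' a ha b hb h
  · rw [hsw]
    refine ⟨hcl, fun x hx => ?_, fun x hx h => ?_, fun x hx => ?_, fun x hx h => ?_,
      fun a ha c hc h1 h2 => ?_⟩
    · exact N.functional _ _ _ (hs _ (hcl x hx)) (N.symm _ _ (hs x hx))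
    · have := hs x hx
      rw [hinj _ (hcl x hx) x hx h] at this
      exact N.irrefl _ this
    · exact (N.label_eq _ _ (hs x hx)).symm
    · exact N.depth_eq _ _ (hs x hx) (hpos _ hx _ (hcl x hx) h)
    · obtain ⟨h3, h4⟩ := N.noncrossing _ _ _ _ (hs a ha) (hs c hc) (hpos _ ha _ hc h1)
        (hpos _ hc _ (hcl a ha) h2)
      exact ⟨hpos' _ ha _ (hcl c hc) h3, hpos' _ (hcl c hc) _ (hcl a ha) h4⟩

end TypeNet

/-- `sequentType` folds the antecedent so that its first member is the innermost argument. Each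
unfolding step turns the outermost division of the goal into an antecedent member. -/
theorem IsNet.exists_sequent {α : Type} {s : α → α} {lab : α → Option ℕ} {pos dep : α → ℕ}
    (Φ : List Tp) (D : Tp) {E : DTp α} (hE : E.erase = sequentType Φ D)
    (h : IsNet s lab pos dep [] E) :
    ∃ Φ' D', Φ'.map DTp.erase = Φ ∧ D'.erase = D ∧ IsNet s lab pos dep Φ' D' := by
  induction Φ generalizing D with
  | nil => exact ⟨[], E, rfl, hE, h⟩
  | cons A Φ ih =>
    obtain ⟨Φ', D', rfl, hD, hnet⟩ := ih (Tp.ldiv A D) hE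
    cases D' with
    | leaf i x => cases hD
    | bang B => cases hD
    | weak B => cases hD
    | ldiv A' D' =>
      cases hD
      exact ⟨A' :: Φ', D', rfl, rfl, hnet.of_ldiv⟩

end LambekBang

theorem mainTheorem1 (Φ : List LambekBang.Tp) (D : LambekBang.Tp)
    (h : Nonempty (LambekBang.ProofNet Φ D)) : LambekBang.Derivable Φ D := by
  obtain ⟨N⟩ := h
  obtain ⟨s, pos, hnet⟩ := N.exists_isNet
  obtain ⟨Φ', D', hΦ, hD, h'⟩ := hnet.exists_sequent Φ D (LambekBang.erase_decorate _ _)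
  have hder := h'.derivable
  rwa [hΦ, hD] at hder
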